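/- **Notation.** For $K=\mathbb R,\mathbb C$ let $K((1/v))^c$ be the field of Laurent series in $w=1/v$ over $K$ converging on some punctured disk about $w=0$. A *polynomial phase function* is (the germ as $v\to+\infty$ of) a continuous function $\phi$ with $f(v)\in\mathbb R_{>0}e^{i\pi\phi(v)}$ for $v\gg0$, for some $0\ne f\in\mathbb C((1/v))^c$; write $\phi\prec\psi$ (resp. $\phi\preceq\psi$) if $\phi(v)<\psi(v)$ (resp. $\phi(v)\le\psi(v)$) for all $v\gg0$. Let $\mathcal A$ be the heart of a bounded t-structure on a triangulated category $\mathcal D$. A *weak polynomial stability function* on $\mathcal A$ with respect to $(\phi_0,\phi_0+1]$ ($\phi_0$ a polynomial phase function) is a homomorphism $Z:K(\mathcal D)\to\mathbb C((1/v))^c$ such that $Z(E)(v)\in\mathbb R_{\ge0}\,e^{i\pi(\phi_0(v),\phi_0(v)+1]}$ for $v\gg0$, for every $0\neq E\in\mathcal A$. Put $\mathcal A_{\ker Z}=\{E\in\mathcal A: Z(E)=0\}$. *Weak polynomial stability data* $(Z,\mathcal A,S)$ consist of such a $Z$ and a family $S$ of polynomial phase functions $\phi_k$ with $\phi_0\prec\phi_k\preceq\phi_0+1$,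 one for each nonzero $k\in\mathcal A_{\ker Z}$, depending only on the isomorphism class of $k$. For $0\ne E\in\mathcal A$ set $\phi_Z(E)=\phi_E$ if $Z(E)=0$; otherwise $\phi_Z(E)$ is determined by $Z(E)(v)\in\mathbb R_{>0}e^{i\pi\phi_Z(E)(v)}$ for $v\gg 0$ and $\phi_0\prec\phi_Z(E)\preceq\phi_0+1$. A nonzero $E\in\mathcal A$ is *$Z$-semistable* if $\phi_Z(M)\preceq\phi_Z(N)$ for every short exact sequence $0\to M\to E\to N\to0$ in $\mathcal A$ with $M,N\ne0$; an object $E\in\mathcal D$ is $Z$-semistable if some shift $E[j]$ is a $Z$-semistable object of $\mathcal A$. $Z$ has the *HN property* on $\mathcal A$ if every nonzero $E\in\mathcal A$ has a filtration $0=E_0\subsetneq E_1\subsetneq\dots\subsetneq E_m=E$ in $\mathcal A$, $m\ge1$, with $Z$-semistable quotients and $\phi_Z(E_1/E_0)\succ\dots\succ\phi_Z(E_m/E_{m-1})$. The data have the *weak seesaw property* if for every short exact sequence $0\to E'\to E\to E''\to0$ of nonzero objects of $\mathcal A$ either $\phi_Z(E')\preceq\phi_Z(E)\preceq\phi_Z(E'')$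 or $\phi_Z(E')\succeq\phi_Z(E)\succeq\phi_Z(E'')$. Let $T\in\mathrm{GL}(2,\mathbb R((1/v))^c)$ with $\det T(v)>0$ for $v\gg0$. Lifting the path $v\mapsto T(v)$ ($v\ge v_1$) to the universal cover of $\mathrm{GL}^+(2,\mathbb R)$ gives a continuous family of increasing bijections $g_v:\mathbb R\to\mathbb R$ with $g_v(x+1)=g_v(x)+1$ and $T(v)e^{i\pi x}\in\mathbb R_{>0}e^{i\pi g_v(x)}$; put $\Gamma_T(\phi)(v)=g_v(\phi(v))$, a bijection on polynomial phase functions (depending on the choice of the lift). **Configuration III-w.** (a) $\Phi:\mathcal D\to\mathcal U$ and $\Psi:\mathcal U\to\mathcal D$ are exact equivalences of triangulated categories with $\Psi\Phi\cong\mathrm{id}_{\mathcal D}[-1]$ and $\Phi\Psi\cong\mathrm{id}_{\mathcal U}[-1]$. (b) $\mathcal A,\mathcal B$ are hearts of bounded t-structures on $\mathcal D,\mathcal U$ with $\Phi\mathcal A\subset D^{[0,1]}_{\mathcal B}$. (c) $Z_{\mathcal A},Z_{\mathcal B}$ are weak polynomial stability functions on $\mathcal A,\mathcal B$ with respect to $(a,a+1]$,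 $(b,b+1]$, and $T$ as above, with a choice of $\Gamma_T$, satisfies $Z_{\mathcal B}(\Phi E)=T\,Z_{\mathcal A}(E)$ for all $E\in\mathcal D$ (where $\mathbb C((1/v))^c$ is identified with column vectors of length $2$ over $\mathbb R((1/v))^c$) and $a\prec\Gamma_T^{-1}(b)\prec a+1$. An object $E\in\mathcal D$ is $\Phi_{\mathcal B}$-WIT$_i$ if $\Phi E[i]\in\mathcal B$; an object $E\in\mathcal U$ is $\Psi_{\mathcal A}$-WIT$_i$ if $\Psi E[i]\in\mathcal A$. **Proposition.** Assume Configuration III-w, and let $(Z_{\mathcal A},\mathcal A,S_{\mathcal A})$, $(Z_{\mathcal B},\mathcal B,S_{\mathcal B})$ be weak polynomial stability data, with phase functions $\phi_{\mathcal A},\phi_{\mathcal B}$, both satisfying the weak seesaw property. Assume moreover: (d) $\Phi(\mathcal A_{\ker Z_{\mathcal A}})=\mathcal B_{\ker Z_{\mathcal B}}$ (as subcategories closed under isomorphism). (e) Every nonzero $F\in\mathcal A_{\ker Z_{\mathcal A}}$ satisfies $\phi_{\mathcal A}(F)\succ\Gamma_T^{-1}(b)$, and every nonzero $F'\in\mathcal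 B_{\ker Z_{\mathcal B}}$ satisfies $\phi_{\mathcal B}(F')\preceq\Gamma_T(a)+1$. (f) For all nonzero $F',F''\in\mathcal A$ that are both $\Phi_{\mathcal B}$-WIT$_i$ for some $i$, $\phi_{\mathcal A}(F')\prec\phi_{\mathcal A}(F'')$ (resp. $\preceq$) implies $\phi_{\mathcal B}(\Phi F'[i])\prec\phi_{\mathcal B}(\Phi F''[i])$ (resp. $\preceq$); and likewise with $\mathcal A,\mathcal B$, $\Phi,\Psi$, $\phi_{\mathcal A},\phi_{\mathcal B}$ interchanged. (g) There are finitely many $Z_{\mathcal A}$-semistable objects in $\mathcal A_{\ker Z_{\mathcal A}}$ such that every object of $\mathcal A_{\ker Z_{\mathcal A}}$ is isomorphic to a finite direct sum of copies of them, and $\Phi$ takes $Z_{\mathcal A}$-semistable objects of $\mathcal A_{\ker Z_{\mathcal A}}$ to $Z_{\mathcal B}$-semistable objects; likewise with $\mathcal A,\mathcal B$, $Z_{\mathcal A},Z_{\mathcal B}$, $\Phi,\Psi$ interchanged (semistability of objects of $\mathcal D,\mathcal U$ being understood up to shift). If $Z_{\mathcal A}$ has the HN property on $\mathcal A$, then $Z_{\mathcal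 B}$ has the HN property on $\mathcal B$. -/

import Mathlib

open CategoryTheory CategoryTheory.Limits CategoryTheory.Pretriangulated
  CategoryTheory.Triangulated Filter

universe v₁ u₁ v₂ u₂

namespace WeakPolyStab

noncomputable section

/-! ### Convergent Laurent series in `w = 1 / v` -/

/-- A Laurent series in `w` converges on some punctured disk around the origin iff it converges
absolutely at some positive radius. -/
def IsConvergent {𝕜 : Type*} [RCLike 𝕜] (f : LaurentSeries 𝕜) : Prop :=
  ∃ r : ℝ, 0 < r ∧ Summable fun n : ℤ => ‖f.coeff n‖ * r ^ n

theorem IsConvergent.of_coeff_le {𝕜 𝕜' : Type*} [RCLike 𝕜] [RCLike 𝕜'] {f : LaurentSeries 𝕜}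
    {g : LaurentSeries 𝕜'} (hf : IsConvergent f) (h : ∀ n, ‖g.coeff n‖ ≤ ‖f.coeff n‖) :
    IsConvergent g := by
  obtain ⟨r, hr, hs⟩ := hf
  exact ⟨r, hr, Summable.of_nonneg_of_le (fun n => by positivity)
    (fun n => mul_le_mul_of_nonneg_right (h n) (by positivity)) hs⟩

theorem exists_lower_bound {𝕜 : Type*} [RCLike 𝕜] (f : LaurentSeries 𝕜) :
    ∃ k : ℤ, ∀ n < k, f.coeff n = 0 := by
  by_cases hf : f = 0
  · exact ⟨0, fun n _ => by simp [hf]⟩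
  · exact ⟨f.order, fun n hn => HahnSeries.coeff_eq_zero_of_lt_order hn⟩

theorem summable_of_le {𝕜 : Type*} [RCLike 𝕜] {f : LaurentSeries 𝕜} {r s : ℝ} (hs : 0 < s)
    (hsr : s ≤ r) (h : Summable fun n : ℤ => ‖f.coeff n‖ * r ^ n) :
    Summable fun n : ℤ => ‖f.coeff n‖ * s ^ n := by
  obtain ⟨k, hk⟩ := exists_lower_bound f
  have hr : 0 < r := hs.trans_le hsr
  refine Summable.of_nonneg_of_le (fun n => by positivity) (fun n => ?_) (h.mul_left ((s / r) ^ k))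
  rcases lt_or_ge n k with hn | hn
  · simp [hk n hn]
  · have h1 : (s / r) ^ n ≤ (s / r) ^ k :=
      zpow_le_zpow_right_of_le_one₀ (by positivity) ((div_le_one hr).2 hsr) hn
    have h2 : s ^ n = (s / r) ^ n * r ^ n := by
      rw [div_zpow, div_mul_cancel₀ _ (by positivity)]
    rw [h2]
    calc ‖f.coeff n‖ * ((s / r) ^ n * r ^ n) = (s / r) ^ n * (‖f.coeff n‖ * r ^ n) := by ring
      _ ≤ (s / r) ^ k * (‖f.coeff n‖ * r ^ n) := mul_le_mul_of_nonneg_right h1 (by positivity)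

theorem IsConvergent.add {𝕜 : Type*} [RCLike 𝕜] {f g : LaurentSeries 𝕜} (hf : IsConvergent f)
    (hg : IsConvergent g) : IsConvergent (f + g) := by
  obtain ⟨r, hr, hf⟩ := hf
  obtain ⟨s, hs, hg⟩ := hg
  have hm : 0 < min r s := lt_min hr hs
  refine ⟨min r s, hm, Summable.of_nonneg_of_le (fun n => by positivity) (fun n => ?_)
    ((summable_of_le hm (min_le_left _ _) hf).add (summable_of_le hm (min_le_right _ _) hg))⟩
  rw [← add_mul, HahnSeries.coeff_add]
  exact mul_le_mul_of_nonneg_right (norm_add_le _ _) (by positivity)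

theorem IsConvergent.mul {𝕜 : Type*} [RCLike 𝕜] {f g : LaurentSeries 𝕜} (hf : IsConvergent f)
    (hg : IsConvergent g) : IsConvergent (f * g) := by
  obtain ⟨r, hr, hf⟩ := hf
  obtain ⟨s, hs, hg⟩ := hg
  have hm : 0 < min r s := lt_min hr hs
  replace hf := summable_of_le hm (min_le_left _ _) hf
  replace hg := summable_of_le hm (min_le_right _ _) hg
  generalize min r s = t at hm hf hg
  let F : ℤ × ℤ → ℝ := fun p => (‖f.coeff p.1‖ * t ^ p.1) * (‖g.coeff p.2‖ * t ^ p.2)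
  have hF : Summable F :=
    hf.mul_of_nonneg hg (fun n => by positivity) (fun n => by positivity)
  have hF0 : ∀ p, 0 ≤ F p := fun p => by positivity
  let e : ℤ × ℤ ≃ ℤ × ℤ :=
    { toFun := fun p => (p.2, p.1 - p.2)
      invFun := fun p => (p.1 + p.2, p.1)
      left_inv := fun p => by simp
      right_inv := fun p => by simp }
  have hFe : Summable (F ∘ e) := e.summable_iff.2 hF
  obtain ⟨hfib, htot⟩ := (summable_prod_of_nonneg (fun p => hF0 (e p))).1 hFe
  refine ⟨t, hm, Summable.of_nonneg_of_le (fun n => by positivity) (fun n => ?_) htot⟩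
  let A := Finset.antidiagonal f.isPWO_support g.isPWO_support n
  have hA : ∀ p ∈ A, p.1 + p.2 = n := fun p hp => (Finset.mem_antidiagonal.1 hp).2.2
  have hinj : Set.InjOn Prod.fst (A : Set (ℤ × ℤ)) := by
    intro p hp q hq h
    have h1 := hA p hp
    have h2 := hA q hq
    ext
    · exact h
    · have h : p.1 = q.1 := h
      omega
  calc ‖(f * g).coeff n‖ * t ^ n
      ≤ (∑ p ∈ A, ‖f.coeff p.1‖ * ‖g.coeff p.2‖) * t ^ n := by
        rw [HahnSeries.coeff_mul]
        refine mul_le_mul_of_nonneg_right ((norm_sum_le _ _).trans ?_) (by positivity)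
        exact Finset.sum_le_sum fun p _ => (norm_mul _ _).le
    _ = ∑ p ∈ A, F (e (n, p.1)) := by
        rw [Finset.sum_mul]
        refine Finset.sum_congr rfl fun p hp => ?_
        have h1 : n - p.1 = p.2 := by have := hA p hp; omega
        have h2 : t ^ n = t ^ p.1 * t ^ p.2 := by rw [← hA p hp, zpow_add₀ hm.ne']
        simp only [F, e, Equiv.coe_fn_mk, h1, h2]
        ring
    _ = ∑ i ∈ A.image Prod.fst, F (e (n, i)) := (Finset.sum_image (f := fun i => F (e (n, i))) hinj).symm
    _ ≤ ∑' i, F (e (n, i)) := (hfib n).sum_le_tsum _ fun i _ => hF0 _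

theorem isConvergent_single {𝕜 : Type*} [RCLike 𝕜] (m : ℤ) (c : 𝕜) :
    IsConvergent (HahnSeries.single m c : LaurentSeries 𝕜) := by
  refine ⟨1, one_pos, summable_of_ne_finset_zero (s := {m}) fun n hn => ?_⟩
  have : n ≠ m := by simpa using hn
  simp [HahnSeries.coeff_single_of_ne this]

/-- The ring (in fact a field) `𝕜((1/v))ᶜ` of convergent Laurent series in `w = 1 / v`. -/
def ConvLaurent (𝕜 : Type*) [RCLike 𝕜] : Subring (LaurentSeries 𝕜) where
  carrier := {f | IsConvergent f}
  mul_mem' := IsConvergent.mul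
  add_mem' := IsConvergent.add
  one_mem' := isConvergent_single 0 1
  zero_mem' := by simpa using isConvergent_single (𝕜 := 𝕜) 0 0
  neg_mem' := fun hf => hf.of_coeff_le fun n => by simp

/-- The value `f(v) = ∑ₙ aₙ v⁻ⁿ` of `f = ∑ₙ aₙ wⁿ`, `w = 1 / v`; the series converges for `v ≫ 0`. -/
def evalAt {𝕜 : Type*} [RCLike 𝕜] (f : ConvLaurent 𝕜) (v : ℝ) : 𝕜 :=
  ∑' n : ℤ, (f : LaurentSeries 𝕜).coeff n * ((v : 𝕜)⁻¹) ^ n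

/-- The coefficientwise real part of a complex series. -/
def rePart (f : ConvLaurent ℂ) : ConvLaurent ℝ :=
  ⟨(f : LaurentSeries ℂ).map Complex.reAddGroupHom,
    IsConvergent.of_coeff_le f.2 fun _ => Complex.abs_re_le_norm _⟩

/-- The coefficientwise imaginary part of a complex series. -/
def imPart (f : ConvLaurent ℂ) : ConvLaurent ℝ :=
  ⟨(f : LaurentSeries ℂ).map Complex.imAddGroupHom,
    IsConvergent.of_coeff_le f.2 fun _ => Complex.abs_im_le_norm _⟩

/-- A complex series as a column vector with two real entries. -/
def toVec (f : ConvLaurent ℂ) : Fin 2 → ConvLaurent ℝ := ![rePart f, imPart f]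

/-! ### Polynomial phase functions

Germs at `v = ∞` are represented by functions `ℝ → ℝ`; all relations below depend only on germs. -/

/-- `φ` is (a representative of the germ of) a polynomial phase function. -/
def IsPolyPhase (φ : ℝ → ℝ) : Prop :=
  ∃ f : ConvLaurent ℂ, f ≠ 0 ∧ ∃ v₀ : ℝ, 0 < v₀ ∧ ContinuousOn φ (Set.Ici v₀) ∧
    ∀ v ≥ v₀, ∃ r : ℝ, 0 < r ∧ evalAt f v = r * Complex.exp (Complex.I * Real.pi * φ v)

/-- The relation `φ ≺ ψ`. -/
def PhaseLT (φ ψ : ℝ → ℝ) : Prop := ∀ᶠ v in atTop, φ v < ψ v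

/-- The relation `φ ≼ ψ`. -/
def PhaseLE (φ ψ : ℝ → ℝ) : Prop := ∀ᶠ v in atTop, φ v ≤ ψ v

/-- For `f(v) ≠ 0`, the value at `v` is the unique `θ ∈ (φ₀ v, φ₀ v + 2]` such that
`f(v) ∈ ℝ_{>0} · exp (iπθ)`. If `f(v) ∈ ℝ_{≥0} · exp (iπ(φ₀ v, φ₀ v + 1])`, as for the values of a
weak polynomial stability function, then `θ ∈ (φ₀ v, φ₀ v + 1]`. -/
def phaseOf (φ₀ : ℝ → ℝ) (f : ConvLaurent ℂ) (v : ℝ) : ℝ :=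
  toIocMod (two_pos : (0 : ℝ) < 2) (φ₀ v) (Complex.arg (evalAt f v) / Real.pi)

/-! ### The group `GL^{l,+}(2, ℝ((1/v))ᶜ)` and its action on phases -/

/-- The value `T_v` of a matrix of convergent series. -/
def evalMatrix (T : GL (Fin 2) (ConvLaurent ℝ)) (v : ℝ) : Matrix (Fin 2) (Fin 2) ℝ :=
  fun i j => evalAt (T.1 i j) v

/-- `T` lies in `GL^{l,+}`: `T_v` has positive determinant for `v ≫ 0`. -/
def IsEventuallyPos (T : GL (Fin 2) (ConvLaurent ℝ)) : Prop :=
  ∀ᶠ v in atTop, 0 < (evalMatrix T v).det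

/-- A lift `v ↦ (T_v, g_v)`, `v ≥ v₁`, of the path `v ↦ T_v` in `GL⁺(2, ℝ)` to the universal cover,
the elements of which are the pairs `(M, g)` of `M ∈ GL⁺(2, ℝ)` and an increasing `g : ℝ → ℝ`
(automatically bijective) with `g (x + 1) = g x + 1` that induces on `ℝ / 2ℤ` the action of `M` on
rays. -/
structure PhaseLift (T : GL (Fin 2) (ConvLaurent ℝ)) where
  v₁ : ℝ
  v₁_pos : 0 < v₁
  det_pos : ∀ v ≥ v₁, 0 < (evalMatrix T v).det
  g : ℝ → ℝ ≃o ℝ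
  map_add_one : ∀ v ≥ v₁, ∀ x, g v (x + 1) = g v x + 1
  map_ray : ∀ v ≥ v₁, ∀ x, ∃ r : ℝ, 0 < r ∧
    (evalMatrix T v).mulVec ![Real.cos (Real.pi * x), Real.sin (Real.pi * x)] =
      r • ![Real.cos (Real.pi * g v x), Real.sin (Real.pi * g v x)]
  continuousOn : ContinuousOn (fun p : ℝ × ℝ => g p.1 p.2) (Set.Ici v₁ ×ˢ Set.univ)

/-- The bijection `Γ_T` on germs of phase functions. -/
def PhaseLift.Γ {T : GL (Fin 2) (ConvLaurent ℝ)} (L : PhaseLift T) (φ : ℝ → ℝ) (v : ℝ) : ℝ :=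
  L.g v (φ v)

/-- The inverse of `Γ_T`. -/
def PhaseLift.Γinv {T : GL (Fin 2) (ConvLaurent ℝ)} (L : PhaseLift T) (φ : ℝ → ℝ) (v : ℝ) : ℝ :=
  (L.g v).symm (φ v)

/-! ### Grothendieck groups and weak polynomial stability data -/

section Triangulated

variable {D : Type u₁} [Category.{v₁} D] [Preadditive D] [HasZeroObject D] [HasShift D ℤ]
  [∀ n : ℤ, (shiftFunctor D n).Additive] [Pretriangulated D]

variable (D) in
/-- The relations `[X₂] - [X₁] - [X₃]` for the distinguished triangles `X₁ ⟶ X₂ ⟶ X₃ ⟶ X₁⟦1⟧`. -/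
def K0Relations : AddSubgroup (FreeAbelianGroup D) :=
  AddSubgroup.closure {x | ∃ T : Triangle D, T ∈ distTriang D ∧
    x = FreeAbelianGroup.of T.obj₂ - FreeAbelianGroup.of T.obj₁ - FreeAbelianGroup.of T.obj₃}

variable (D) in
/-- The Grothendieck group `K(D)` of a triangulated category. -/
abbrev K0 : Type u₁ := FreeAbelianGroup D ⧸ K0Relations D

/-- The class of an object in the Grothendieck group. -/
def K0.of (X : D) : K0 D := QuotientAddGroup.mk (FreeAbelianGroup.of X)

/-- The heart of a t-structure as a category. -/
abbrev HeartCat (t : TStructure D) : Type u₁ := t.heart.FullSubcategory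

/-- The objects of the heart on which `Z` vanishes. -/
def kerObj (t : TStructure D) (Z : K0 D →+ ConvLaurent ℂ) : ObjectProperty D :=
  fun X => t.heart X ∧ Z (K0.of X) = 0

/-- `Z` is a weak polynomial stability function on the heart of `t` with respect to
`(φ₀, φ₀ + 1]`. -/
structure IsStabilityFunction (t : TStructure D) (φ₀ : ℝ → ℝ) (Z : K0 D →+ ConvLaurent ℂ) :
    Prop where
  isPolyPhase : IsPolyPhase φ₀
  mem_sector : ∀ E : D, t.heart E → ¬ IsZero E → ∀ᶠ v in atTop,
    ∃ r : ℝ, 0 ≤ r ∧ ∃ θ ∈ Set.Ioc (φ₀ v) (φ₀ v + 1),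
      evalAt (Z (K0.of E)) v = r * Complex.exp (Complex.I * Real.pi * θ)

/-- Weak polynomial stability data `(Z, A, S)` with respect to `(φ₀, φ₀ + 1]`, where `A` is the
heart of the bounded t-structure `t`. The family `S` of phases of the nonzero objects of the heart
on which `Z` vanishes is given by `kerPhase`, whose values at other objects are irrelevant. -/
structure StabilityData (t : TStructure D) (φ₀ : ℝ → ℝ) where
  bounded : ∀ X : D, t.bounded X
  Z : K0 D →+ ConvLaurent ℂ
  isStabilityFunction : IsStabilityFunction t φ₀ Z
  kerPhase : HeartCat t → ℝ → ℝ
  kerPhase_isPolyPhase : ∀ k : HeartCat t, kerObj t Z k.obj → ¬ IsZero k →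
    IsPolyPhase (kerPhase k)
  lt_kerPhase : ∀ k : HeartCat t, kerObj t Z k.obj → ¬ IsZero k → PhaseLT φ₀ (kerPhase k)
  kerPhase_le : ∀ k : HeartCat t, kerObj t Z k.obj → ¬ IsZero k →
    PhaseLE (kerPhase k) fun v => φ₀ v + 1
  kerPhase_congr : ∀ k k' : HeartCat t, kerObj t Z k.obj → ¬ IsZero k → Nonempty (k ≅ k') →
    kerPhase k =ᶠ[atTop] kerPhase k'

namespace StabilityData

variable {t : TStructure D} {φ₀ : ℝ → ℝ} (σ : StabilityData t φ₀)

open Classical in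
/-- The phase function of a nonzero object of the heart. -/
def phase (E : HeartCat t) : ℝ → ℝ :=
  if σ.Z (K0.of E.obj) = 0 then σ.kerPhase E else phaseOf φ₀ (σ.Z (K0.of E.obj))

/-- The weak seesaw property. -/
def WeakSeesaw : Prop :=
  ∀ S : ShortComplex (HeartCat t), S.ShortExact → ¬ IsZero S.X₁ → ¬ IsZero S.X₂ → ¬ IsZero S.X₃ →
    (PhaseLE (σ.phase S.X₁) (σ.phase S.X₂) ∧ PhaseLE (σ.phase S.X₂) (σ.phase S.X₃)) ∨
    (PhaseLE (σ.phase S.X₂) (σ.phase S.X₁) ∧ PhaseLE (σ.phase S.X₃) (σ.phase S.X₂))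

/-- Semistability of an object of the heart. -/
def IsSemistable (E : HeartCat t) : Prop :=
  ¬ IsZero E ∧ ∀ (M N : HeartCat t) (i : M ⟶ E) (p : E ⟶ N) (w : i ≫ p = 0),
    (ShortComplex.mk i p w).ShortExact → ¬ IsZero M → ¬ IsZero N →
      PhaseLE (σ.phase M) (σ.phase N)

/-- Semistability of an object of the triangulated category: some shift of it is a semistable
object of the heart. -/
def IsSemistableObj (X : D) : Prop :=
  ∃ (j : ℤ) (h : t.heart (X⟦j⟧)), σ.IsSemistable ⟨X⟦j⟧, h⟩

/-- A Harder–Narasimhan filtration of `E`, with factors `Q i`. -/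
structure HNFiltration (E : HeartCat t) where
  m : ℕ
  one_le : 1 ≤ m
  F : Fin (m + 1) → Subobject E
  strictMono : StrictMono F
  isZero_zero : IsZero (F 0 : HeartCat t)
  last_eq_top : F (Fin.last m) = ⊤
  Q : Fin m → HeartCat t
  π : ∀ i : Fin m, (F i.succ : HeartCat t) ⟶ Q i
  w : ∀ i : Fin m,
    (F i.castSucc).ofLE (F i.succ) (strictMono.monotone i.castSucc_le_succ) ≫ π i = 0
  shortExact : ∀ i : Fin m, (ShortComplex.mk _ _ (w i)).ShortExact
  semistable : ∀ i : Fin m, σ.IsSemistable (Q i)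
  phase_lt : ∀ i j : Fin m, i < j → PhaseLT (σ.phase (Q j)) (σ.phase (Q i))

/-- The Harder–Narasimhan property. -/
def HNProperty : Prop := ∀ E : HeartCat t, ¬ IsZero E → Nonempty (σ.HNFiltration E)

/-- The objects of the heart on which `Z` vanishes are generated via direct sums by finitely many
semistable objects among them. -/
def KerFinitelyGenerated : Prop :=
  ∃ (n : ℕ) (G : Fin n → HeartCat t),
    (∀ i, kerObj t σ.Z (G i).obj ∧ σ.IsSemistable (G i)) ∧
    ∀ X : D, kerObj t σ.Z X →
      ∃ (m : ℕ) (c : Fin m → Fin n), Nonempty (X ≅ ⨁ fun j => (G (c j)).obj)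

end StabilityData

end Triangulated

/-! ### Configuration III-w -/

section Config

variable {D : Type u₁} [Category.{v₁} D] [Preadditive D] [HasZeroObject D] [HasShift D ℤ]
  [∀ n : ℤ, (shiftFunctor D n).Additive] [Pretriangulated D]
  {U : Type u₂} [Category.{v₂} U] [Preadditive U] [HasZeroObject U] [HasShift U ℤ]
  [∀ n : ℤ, (shiftFunctor U n).Additive] [Pretriangulated U]

/-- An object `E` is `Φ_B`-WIT_i if `Φ E ∈ B[-i]`, where `B` is the heart of `t`. -/
def IsWIT (Φ : D ⥤ U) (t : TStructure U) (i : ℤ) (E : D) : Prop :=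
  t.heart ((Φ.obj E)⟦i⟧)

/-- The conditions of Configuration III-w on exact equivalences `Φ`, `Ψ`, hearts of bounded
t-structures with weak polynomial stability functions, a matrix `T` and a choice of `Γ_T`. -/
structure ConfigIIIw (Φ : D ⥤ U) (Ψ : U ⥤ D) {tA : TStructure D} {tB : TStructure U}
    {a b : ℝ → ℝ} (σA : StabilityData tA a) (σB : StabilityData tB b)
    (T : GL (Fin 2) (ConvLaurent ℝ)) (L : PhaseLift T) : Prop where
  comp_iso : Nonempty (Φ ⋙ Ψ ≅ shiftFunctor D (-1 : ℤ))
  comp_iso' : Nonempty (Ψ ⋙ Φ ≅ shiftFunctor U (-1 : ℤ))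
  amplitude : ∀ E : D, tA.heart E → tB.IsGE (Φ.obj E) 0 ∧ tB.IsLE (Φ.obj E) 1
  eventuallyPos : IsEventuallyPos T
  charge : ∀ E : D, toVec (σB.Z (K0.of (Φ.obj E))) = T.1.mulVec (toVec (σA.Z (K0.of E)))
  lt_Γinv : PhaseLT a (L.Γinv b)
  Γinv_lt : PhaseLT (L.Γinv b) fun v => a v + 1

end Config

end

end WeakPolyStab

namespace WeakPolyStab

/-! ### Evaluation of convergent Laurent series -/

section Evaluation

variable {𝕜 : Type*} [RCLike 𝕜]

/-! Pull the heart of `tB` back along `Φ`, so that both hearts A and B live in `D`. As A has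
amplitude [0,1] for B and comes from a bounded t-structure, orthogonality puts B in amplitude [-1,0]
for A: B is a tilt of A. Call A ∩ B the torsion objects and A ∩ B[-1] the torsion-free ones.
Truncation writes each object of A as an extension of a torsion-free object by a torsion one, and
each object of B as an extension of a torsion object Y₀ by a shifted torsion-free object Y₁[1]
(`exists_tri₁`, `exists_tri₂`).

Phases detect this torsion pair. Put c = Γ⁻¹(b) and d = Γ(a) + 1. Because b lies strictly between
Γ(a) and Γ(a) + 1, comparing the two windows of phases shows that nonzero torsion objects have
A-phase above c and B-phase at most d, while nonzero torsion-free objects X have A-phase at most c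
and X[1] has B-phase above d (`phase_cut₀`, `phase_cut₁`). For objects of zero charge the first half
is the assumption on the kernels; a nonzero torsion-free object never has zero charge, since `Φ`
matches the kernels.

Hence an A-semistable object is torsion or torsion-free (`heart_or_heart_shift`), and it, or its
shift, is B-semistable (`semistable₀`, `semistable₁`): the octahedral axiom turns a short exact
sequence in B into sequences in A, and the weak seesaw property carries the inequality across. The
HN factors in A of a torsion (torsion-free) object are again torsion (torsion-free), so these
filtrations pass to B. For an arbitrary object of B the filtrations of Y₁[1] and Y₀ are
concatenated, their phases lying on opposite sides of d. -/

theorem eventually_summable (f : ConvLaurent 𝕜) :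
    ∀ᶠ v : ℝ in atTop, 0 < v ∧
      Summable fun n : ℤ => ‖(f : LaurentSeries 𝕜).coeff n * ((v : 𝕜)⁻¹) ^ n‖ := by
  obtain ⟨r, hr, hs⟩ := f.2
  filter_upwards [eventually_ge_atTop r⁻¹, eventually_gt_atTop 0] with v hv hv0
  refine ⟨hv0, ?_⟩
  have h := summable_of_le (inv_pos.2 hv0) (inv_le_of_inv_le₀ hr hv) hs
  refine h.congr fun n => ?_
  rw [norm_mul, norm_zpow, norm_inv, RCLike.norm_ofReal, abs_of_pos hv0]

theorem evalAt_neg (f : ConvLaurent 𝕜) (v : ℝ) : evalAt (-f) v = -evalAt f v := by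
  simp [evalAt, tsum_neg]

theorem evalAt_add (f g : ConvLaurent 𝕜) :
    ∀ᶠ v : ℝ in atTop, evalAt (f + g) v = evalAt f v + evalAt g v := by
  filter_upwards [eventually_summable f, eventually_summable g] with v hf hg
  rw [evalAt, evalAt, evalAt, ← hf.2.of_norm.tsum_add hg.2.of_norm]
  exact tsum_congr fun n => by simp [add_mul]

/-- Cauchy product over ℤ: absolute convergence allows regrouping the double sum along the lines of
constant index sum. -/
theorem tsum_mul_tsum_eq_tsum_tsum_sub {F G : ℤ → 𝕜} (hF : Summable fun n => ‖F n‖)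
    (hG : Summable fun n => ‖G n‖) :
    (∑' n, F n) * ∑' n, G n = ∑' n, ∑' i, F i * G (n - i) := by
  rw [tsum_mul_tsum_of_summable_norm hF hG]
  have h := summable_mul_of_summable_norm hF hG
  let e : ℤ × ℤ ≃ ℤ × ℤ :=
    { toFun := fun p => (p.2, p.1 - p.2)
      invFun := fun p => (p.1 + p.2, p.1)
      left_inv := fun p => by simp
      right_inv := fun p => by simp }
  have he : Summable fun p : ℤ × ℤ => F (e p).1 * G (e p).2 := e.summable_iff.2 h
  rw [← e.tsum_eq, he.tsum_prod]
  rfl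

/-- Only finitely many terms are nonzero: they are indexed by the finite antidiagonal of the two
supports, which also defines the product of Hahn series. -/
theorem tsum_coeff_mul_coeff_sub (f g : LaurentSeries 𝕜) {t : 𝕜} (ht : t ≠ 0) (n : ℤ) :
    ∑' i, (f.coeff i * t ^ i) * (g.coeff (n - i) * t ^ (n - i)) = (f * g).coeff n * t ^ n := by
  let A := Finset.antidiagonal f.isPWO_support g.isPWO_support n
  have hA : ∀ p ∈ A, p.1 + p.2 = n := fun p hp => (Finset.mem_antidiagonal.1 hp).2.2
  have hinj : Set.InjOn Prod.fst (A : Set (ℤ × ℤ)) := by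
    intro p hp q hq h
    have h1 := hA p hp
    have h2 := hA q hq
    have h : p.1 = q.1 := h
    ext
    · exact h
    · omega
  rw [tsum_eq_sum (s := A.image Prod.fst), Finset.sum_image hinj, HahnSeries.coeff_mul,
    Finset.sum_mul]
  · refine Finset.sum_congr rfl fun p hp => ?_
    have h1 : n - p.1 = p.2 := by have := hA p hp; omega
    rw [h1, ← hA p hp, zpow_add₀ ht]
    ring
  · intro i hi
    by_cases hfi : f.coeff i = 0
    · rw [hfi, zero_mul, zero_mul]
    · by_cases hgi : g.coeff (n - i) = 0
      · rw [hgi, zero_mul, mul_zero]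
      · refine absurd (Finset.mem_image.2 ⟨(i, n - i), ?_, rfl⟩) hi
        exact Finset.mem_antidiagonal.2 ⟨hfi, hgi, add_sub_cancel _ _⟩

theorem evalAt_mul (f g : ConvLaurent 𝕜) :
    ∀ᶠ v : ℝ in atTop, evalAt (f * g) v = evalAt f v * evalAt g v := by
  filter_upwards [eventually_summable f, eventually_summable g] with v hf hg
  have ht : ((v : 𝕜)⁻¹) ≠ 0 := inv_ne_zero (RCLike.ofReal_ne_zero.2 hf.1.ne')
  rw [evalAt, evalAt, evalAt, tsum_mul_tsum_eq_tsum_tsum_sub hf.2 hg.2]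
  exact tsum_congr fun n => (tsum_coeff_mul_coeff_sub _ _ ht n).symm

/-- The term of lowest order k in w = 1/v dominates: the remaining terms together are O(w^(k+1)). -/
theorem eventually_evalAt_ne_zero {f : ConvLaurent 𝕜} (hf : f ≠ 0) :
    ∀ᶠ v : ℝ in atTop, evalAt f v ≠ 0 := by
  obtain ⟨f, hconv⟩ := f
  replace hf : f ≠ 0 := fun h => hf (Subtype.ext h)
  obtain ⟨r, hr, hs⟩ := hconv
  set k := f.order with hk
  set C := ∑' n : ℤ, ‖f.coeff n‖ * r ^ n with hC
  have hc : 0 < ‖f.coeff k‖ := norm_pos_iff.2 (HahnSeries.coeff_order_eq_zero.not.2 hf)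
  -- `K` is the constant in the tail bound K · w^(k+1), coming from (w/r)^n ≤ (w/r)^(k+1) for n > k
  -- and w ≤ r.
  set K := C * r ^ (-(k + 1)) with hK
  have hlim : Tendsto (fun v : ℝ => K * v⁻¹) atTop (nhds 0) := by
    simpa using tendsto_inv_atTop_zero.const_mul K
  filter_upwards [eventually_ge_atTop r⁻¹, eventually_gt_atTop 0,
    hlim.eventually (gt_mem_nhds hc)] with v hv hv0 hsmall h0
  have ht : 0 < v⁻¹ := inv_pos.2 hv0
  have htr : v⁻¹ ≤ r := inv_le_of_inv_le₀ hr hv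
  have hsum := summable_of_le ht htr hs
  have hnorm : ∀ n : ℤ, ‖f.coeff n * ((v : 𝕜)⁻¹) ^ n‖ = ‖f.coeff n‖ * v⁻¹ ^ n := fun n => by
    rw [norm_mul, norm_zpow, norm_inv, RCLike.norm_ofReal, abs_of_pos hv0]
  have hsum' : Summable fun n : ℤ => f.coeff n * ((v : 𝕜)⁻¹) ^ n :=
    Summable.of_norm (hsum.congr fun n => (hnorm n).symm)
  have hsplit := hsum'.tsum_eq_add_tsum_ite k
  have h0' : ∑' n : ℤ, f.coeff n * ((v : 𝕜)⁻¹) ^ n = 0 := h0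
  rw [h0'] at hsplit
  have hb : ∀ n : ℤ, ‖if n = k then (0 : 𝕜) else f.coeff n * ((v : 𝕜)⁻¹) ^ n‖ ≤
      (v⁻¹ ^ (k + 1) * r ^ (-(k + 1))) * (‖f.coeff n‖ * r ^ n) := by
    intro n
    split_ifs with hn
    · rw [norm_zero]; positivity
    · rw [hnorm]
      rcases lt_or_gt_of_ne hn with hn | hn
      · simp [HahnSeries.coeff_eq_zero_of_lt_order hn]
      · have h1 : (v⁻¹ / r) ^ n ≤ (v⁻¹ / r) ^ (k + 1) :=
          zpow_le_zpow_right_of_le_one₀ (by positivity) ((div_le_one hr).2 htr) hn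
        have h2 : v⁻¹ ^ n = (v⁻¹ / r) ^ n * r ^ n := by
          rw [div_zpow, div_mul_cancel₀ _ (by positivity)]
        have h3 : v⁻¹ ^ (k + 1) * r ^ (-(k + 1)) = (v⁻¹ / r) ^ (k + 1) := by
          rw [div_zpow, zpow_neg]; rfl
        rw [h2, h3]
        calc ‖f.coeff n‖ * ((v⁻¹ / r) ^ n * r ^ n)
            = (v⁻¹ / r) ^ n * (‖f.coeff n‖ * r ^ n) := by ring
          _ ≤ _ := mul_le_mul_of_nonneg_right h1 (by positivity)
  have htail := tsum_of_norm_bounded (hs.hasSum.mul_left _) hb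
  have heq : ‖f.coeff k * ((v : 𝕜)⁻¹) ^ k‖ ≤ v⁻¹ ^ (k + 1) * r ^ (-(k + 1)) * C := by
    rw [eq_neg_of_add_eq_zero_left hsplit.symm, norm_neg]
    exact htail
  rw [hnorm, zpow_add_one₀ ht.ne'] at heq
  have hp : 0 < v⁻¹ ^ k := by positivity
  have : ‖f.coeff k‖ * v⁻¹ ^ k ≤ (K * v⁻¹) * v⁻¹ ^ k := by
    rw [hK]; linarith
  exact absurd (le_of_mul_le_mul_right this hp) (not_le.2 hsmall)

end Evaluation

theorem evalAt_rePart (f : ConvLaurent ℂ) :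
    ∀ᶠ v : ℝ in atTop, evalAt (rePart f) v = (evalAt f v).re := by
  filter_upwards [eventually_summable f] with v hf
  rw [evalAt, evalAt, Complex.re_tsum hf.2.of_norm]
  refine tsum_congr fun n => ?_
  have : ((v : ℂ)⁻¹) ^ n = ((v⁻¹ ^ n : ℝ) : ℂ) := by push_cast; rfl
  erw [this, Complex.re_mul_ofReal]
  rfl

theorem evalAt_imPart (f : ConvLaurent ℂ) :
    ∀ᶠ v : ℝ in atTop, evalAt (imPart f) v = (evalAt f v).im := by
  filter_upwards [eventually_summable f] with v hf
  rw [evalAt, evalAt, Complex.im_tsum hf.2.of_norm]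
  refine tsum_congr fun n => ?_
  have : ((v : ℂ)⁻¹) ^ n = ((v⁻¹ ^ n : ℝ) : ℂ) := by push_cast; rfl
  erw [this, Complex.im_mul_ofReal]
  rfl

theorem evalAt_mulVec {T : GL (Fin 2) (ConvLaurent ℝ)} {z z' : ConvLaurent ℂ}
    (h : toVec z' = T.1.mulVec (toVec z)) :
    ∀ᶠ v : ℝ in atTop, ![(evalAt z' v).re, (evalAt z' v).im] =
      (evalMatrix T v).mulVec ![(evalAt z v).re, (evalAt z v).im] := by
  have h0 := congrFun h 0
  have h1 := congrFun h 1
  simp only [toVec, Matrix.mulVec, dotProduct, Fin.sum_univ_two, Matrix.cons_val_zero,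
    Matrix.cons_val_one] at h0 h1
  filter_upwards [evalAt_rePart z, evalAt_imPart z, evalAt_rePart z', evalAt_imPart z',
    evalAt_mul (T.1 0 0) (rePart z), evalAt_mul (T.1 0 1) (imPart z),
    evalAt_mul (T.1 1 0) (rePart z), evalAt_mul (T.1 1 1) (imPart z),
    evalAt_add (T.1 0 0 * rePart z) (T.1 0 1 * imPart z),
    evalAt_add (T.1 1 0 * rePart z) (T.1 1 1 * imPart z)] with
    v e1 e2 e3 e4 e5 e6 e7 e8 e9 e10
  rw [← h0, e5, e6] at e9
  rw [← h1, e7, e8] at e10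
  ext i
  fin_cases i
  · simpa [Matrix.mulVec, dotProduct, Fin.sum_univ_two, evalMatrix, e1, e2, e3] using e9
  · simpa [Matrix.mulVec, dotProduct, Fin.sum_univ_two, evalMatrix, e1, e2, e4] using e10

theorem toVec_injective : Function.Injective toVec := by
  intro f g h
  have h0 : rePart f = rePart g := congrFun h 0
  have h1 : imPart f = imPart g := congrFun h 1
  apply Subtype.ext
  ext n
  apply Complex.ext
  · exact congrArg (fun x : ConvLaurent ℝ => (x : LaurentSeries ℝ).coeff n) h0
  · exact congrArg (fun x : ConvLaurent ℝ => (x : LaurentSeries ℝ).coeff n) h1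

theorem toVec_zero : toVec 0 = 0 := by
  ext i n
  fin_cases i <;> simp [toVec, rePart, imPart]

/-- `T` is invertible over the ring of series itself, so charges vanish simultaneously as series,
not merely pointwise. -/
theorem eq_zero_iff_of_toVec_eq {T : GL (Fin 2) (ConvLaurent ℝ)} {z z' : ConvLaurent ℂ}
    (h : toVec z' = T.1.mulVec (toVec z)) : z' = 0 ↔ z = 0 := by
  constructor
  · rintro rfl
    apply toVec_injective
    have : toVec z = (T⁻¹).1.mulVec (T.1.mulVec (toVec z)) := by
      rw [Matrix.mulVec_mulVec, ← Units.val_mul, inv_mul_cancel, Units.val_one, Matrix.one_mulVec]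
    rw [this, ← h, toVec_zero, Matrix.mulVec_zero]
  · rintro rfl
    apply toVec_injective
    rw [h, toVec_zero, Matrix.mulVec_zero]

/-! ### Phases of central charges -/

theorem PhaseLE.trans {φ ψ χ : ℝ → ℝ} (h : PhaseLE φ ψ) (h' : PhaseLE ψ χ) : PhaseLE φ χ := by
  filter_upwards [h, h'] with v h h' using h.trans h'

theorem PhaseLE.trans_lt {φ ψ χ : ℝ → ℝ} (h : PhaseLE φ ψ) (h' : PhaseLT ψ χ) : PhaseLT φ χ := by
  filter_upwards [h, h'] with v h h' using h.trans_lt h'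

theorem PhaseLT.trans_le {φ ψ χ : ℝ → ℝ} (h : PhaseLT φ ψ) (h' : PhaseLE ψ χ) : PhaseLT φ χ := by
  filter_upwards [h, h'] with v h h' using h.trans_le h'

theorem PhaseLT.trans {φ ψ χ : ℝ → ℝ} (h : PhaseLT φ ψ) (h' : PhaseLT ψ χ) : PhaseLT φ χ := by
  filter_upwards [h, h'] with v h h' using h.trans h'

theorem PhaseLT.le {φ ψ : ℝ → ℝ} (h : PhaseLT φ ψ) : PhaseLE φ ψ := by
  filter_upwards [h] with v h using h.le

theorem PhaseLT.not_le {φ ψ : ℝ → ℝ} (h : PhaseLT φ ψ) : ¬ PhaseLE ψ φ := fun h' => by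
  obtain ⟨v, h, h'⟩ := (h.and h').exists
  exact absurd h (not_lt.2 h')

theorem PhaseLE.of_eventuallyEq {φ ψ : ℝ → ℝ} (h : φ =ᶠ[atTop] ψ) : PhaseLE φ ψ := by
  filter_upwards [h] with v h using h.le

/-- Norms force equal radii; the period 2πi of the exponential then becomes 2 after division by iπ.
-/
theorem ray_ext {r s x y : ℝ} (hr : 0 < r) (hs : 0 < s)
    (h : (r : ℂ) * Complex.exp (Complex.I * Real.pi * x) =
      s * Complex.exp (Complex.I * Real.pi * y)) : ∃ k : ℤ, x = y + 2 * k := by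
  have hn : ∀ t : ℝ, ‖Complex.exp (Complex.I * Real.pi * t)‖ = 1 := fun t => by
    rw [show Complex.I * Real.pi * t = ((Real.pi * t : ℝ) : ℂ) * Complex.I by push_cast; ring]
    exact Complex.norm_exp_ofReal_mul_I _
  have hrs : r = s := by
    have := congrArg norm h
    simpa [hn, abs_of_pos hr, abs_of_pos hs] using this
  subst hrs
  have h' := mul_left_cancel₀ (Complex.ofReal_ne_zero.2 hr.ne') h
  obtain ⟨k, hk⟩ := Complex.exp_eq_exp_iff_exists_int.1 h'
  refine ⟨k, ?_⟩
  have hpi : (Real.pi : ℂ) ≠ 0 := Complex.ofReal_ne_zero.2 Real.pi_ne_zero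
  have h2 : (x : ℂ) = y + 2 * k := by
    have : Complex.I * Real.pi * ((x : ℂ) - (y + 2 * k)) = 0 := by
      linear_combination hk
    simpa [hpi, sub_eq_zero] using this
  exact_mod_cast h2

/-- The sector condition on a single value. -/
def InSector (φ₀ : ℝ → ℝ) (z : ConvLaurent ℂ) (v : ℝ) : Prop :=
  ∃ r : ℝ, 0 ≤ r ∧ ∃ θ ∈ Set.Ioc (φ₀ v) (φ₀ v + 1),
    evalAt z v = r * Complex.exp (Complex.I * Real.pi * θ)

/-- The sector condition provides a phase in the half window, which differs from arg/π by an even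
integer; reduction into the window of length 2 must therefore return it. -/
theorem phaseOf_spec {φ₀ : ℝ → ℝ} {z : ConvLaurent ℂ} {v : ℝ} (hz : evalAt z v ≠ 0)
    (h : InSector φ₀ z v) :
    phaseOf φ₀ z v ∈ Set.Ioc (φ₀ v) (φ₀ v + 1) ∧
      ∃ r : ℝ, 0 < r ∧
        evalAt z v = r * Complex.exp (Complex.I * Real.pi * (phaseOf φ₀ z v : ℝ)) := by
  obtain ⟨r, hr, θ, hθ, hzr⟩ := h
  have hr : 0 < r := by
    refine hr.lt_of_ne fun h => hz ?_
    rw [hzr, ← h]; simp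
  suffices phaseOf φ₀ z v = θ by rw [this]; exact ⟨hθ, r, hr, hzr⟩
  have hpolar : evalAt z v = (‖evalAt z v‖ : ℝ) *
      Complex.exp (Complex.I * Real.pi * ((Complex.arg (evalAt z v) / Real.pi : ℝ) : ℂ)) := by
    conv_lhs => rw [← Complex.norm_mul_exp_arg_mul_I (evalAt z v)]
    congr 2
    push_cast
    field_simp
  obtain ⟨k, hk⟩ := ray_ext (norm_pos_iff.2 hz) hr (hpolar.symm.trans hzr)
  rw [phaseOf, hk, mul_comm, ← zsmul_eq_mul, toIocMod_add_zsmul]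
  exact (toIocMod_eq_self _).2 ⟨hθ.1, by linarith [hθ.2]⟩

theorem evalAt_eq_of_mulVec {T : GL (Fin 2) (ConvLaurent ℝ)} (L : PhaseLift T)
    {z z' : ConvLaurent ℂ} {v x r : ℝ} (hv : L.v₁ ≤ v)
    (h : ![(evalAt z' v).re, (evalAt z' v).im] =
      (evalMatrix T v).mulVec ![(evalAt z v).re, (evalAt z v).im]) (hr : 0 < r)
    (hz : evalAt z v = r * Complex.exp (Complex.I * Real.pi * x)) :
    ∃ s : ℝ, 0 < s ∧ evalAt z' v = s * Complex.exp (Complex.I * Real.pi * (L.g v x : ℝ)) := by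
  obtain ⟨s, hs, hsx⟩ := L.map_ray v hv x
  have hexp : ∀ t y : ℝ, (t : ℂ) * Complex.exp (Complex.I * Real.pi * y) =
      ⟨t * Real.cos (Real.pi * y), t * Real.sin (Real.pi * y)⟩ := fun t y => by
    rw [show Complex.I * Real.pi * y = ((Real.pi * y : ℝ) : ℂ) * Complex.I by push_cast; ring]
    apply Complex.ext
    · rw [Complex.re_ofReal_mul, Complex.exp_ofReal_mul_I_re]
    · rw [Complex.im_ofReal_mul, Complex.exp_ofReal_mul_I_im]
  refine ⟨r * s, mul_pos hr hs, ?_⟩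
  rw [hexp] at hz ⊢
  have hvec : ![(evalAt z v).re, (evalAt z v).im] =
      r • ![Real.cos (Real.pi * x), Real.sin (Real.pi * x)] := by
    rw [hz]; ext i; fin_cases i <;> simp
  rw [hvec, Matrix.mulVec_smul, hsx, smul_smul] at h
  apply Complex.ext
  · simpa using congrFun h 0
  · simpa using congrFun h 1

/-! ### Comparison of the phase windows of the two charges. -/

section

variable {T : GL (Fin 2) (ConvLaurent ℝ)} (L : PhaseLift T) {a b : ℝ → ℝ}
  {z z' : ConvLaurent ℂ}

include L in
-- `T` moves the window (a, a+1] to (Γa, Γa+1]. The transformed phase and the phase of `z'` in (b,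
-- b+1] agree modulo 2, and the two windows are too close for a nonzero even difference, so this
-- phase lies in both.
theorem phaseOf_transform (hab : PhaseLT a (L.Γinv b))
    (hba : PhaseLT (L.Γinv b) fun v => a v + 1) (hz : z ≠ 0)
    (h : toVec z' = T.1.mulVec (toVec z)) (hsec : ∀ᶠ v in atTop, InSector a z v)
    (hsec' : ∀ᶠ v in atTop, InSector b z' v) :
    PhaseLT (L.Γinv b) (phaseOf a z) ∧ PhaseLE (phaseOf b z') fun v => L.Γ a v + 1 := by
  suffices ∀ᶠ v in atTop, L.Γinv b v < phaseOf a z v ∧ phaseOf b z' v ≤ L.Γ a v + 1 from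
    ⟨this.mono fun _ h => h.1, this.mono fun _ h => h.2⟩
  have hz' : z' ≠ 0 := fun h' => hz ((eq_zero_iff_of_toVec_eq h).1 h')
  filter_upwards [hab, hba, hsec, hsec', eventually_evalAt_ne_zero hz,
    eventually_evalAt_ne_zero hz', evalAt_mulVec h, eventually_ge_atTop L.v₁] with
    v hab hba hsec hsec' hzv hzv' hv hv₁
  obtain ⟨hθ, r, hr, hzr⟩ := phaseOf_spec hzv hsec
  obtain ⟨hθ', r', hr', hzr'⟩ := phaseOf_spec hzv' hsec'
  obtain ⟨s, hs, hzs⟩ := evalAt_eq_of_mulVec L hv₁ hv hr hzr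
  obtain ⟨k, hk⟩ := ray_ext hs hr' (hzs.symm.trans hzr')
  have h1 : L.g v (a v) < b v := (OrderIso.lt_symm_apply _).1 hab
  have h2 : b v < L.g v (a v) + 1 := by
    rw [← L.map_add_one v hv₁]
    exact (OrderIso.symm_apply_lt _).1 hba
  have h3 := (L.g v).lt_iff_lt.2 hθ.1
  have h4 := (L.g v).le_iff_le.2 hθ.2
  rw [L.map_add_one v hv₁] at h4
  -- The difference 2k of the two phases lies strictly between -2 and 2.
  have hk0 : k = 0 := by
    have i1 : (-1 : ℝ) < k := by linarith [hθ'.2]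
    have i2 : (k : ℝ) < 1 := by linarith [hθ'.1]
    have i1 : -1 < k := by exact_mod_cast i1
    have i2 : k < 1 := by exact_mod_cast i2
    omega
  rw [hk0, Int.cast_zero, mul_zero, add_zero] at hk
  refine ⟨(OrderIso.symm_apply_lt _).2 (hk ▸ hθ'.1), ?_⟩
  rw [← hk]
  exact h4

include L in
-- The sign adds 1 to the transformed phase, so the window to intersect with (b, b+1] is now (Γa+1,
-- Γa+2].
theorem phaseOf_transform_neg (hab : PhaseLT a (L.Γinv b))
    (hba : PhaseLT (L.Γinv b) fun v => a v + 1) (hz : z ≠ 0)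
    (h : toVec z' = T.1.mulVec (toVec z)) (hsec : ∀ᶠ v in atTop, InSector a z v)
    (hsec' : ∀ᶠ v in atTop, InSector b (-z') v) :
    PhaseLE (phaseOf a z) (L.Γinv b) ∧ PhaseLT (fun v => L.Γ a v + 1) (phaseOf b (-z')) := by
  suffices ∀ᶠ v in atTop, phaseOf a z v ≤ L.Γinv b v ∧ L.Γ a v + 1 < phaseOf b (-z') v from
    ⟨this.mono fun _ h => h.1, this.mono fun _ h => h.2⟩
  have hz' : -z' ≠ 0 := fun h' => hz ((eq_zero_iff_of_toVec_eq h).1 (neg_eq_zero.1 h'))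
  filter_upwards [hab, hba, hsec, hsec', eventually_evalAt_ne_zero hz,
    eventually_evalAt_ne_zero hz', evalAt_mulVec h, eventually_ge_atTop L.v₁] with
    v hab hba hsec hsec' hzv hzv' hv hv₁
  obtain ⟨hθ, r, hr, hzr⟩ := phaseOf_spec hzv hsec
  obtain ⟨hθ', r', hr', hzr'⟩ := phaseOf_spec hzv' hsec'
  obtain ⟨s, hs, hzs⟩ := evalAt_eq_of_mulVec L hv₁ hv hr hzr
  have hzs' : evalAt (-z') v =
      s * Complex.exp (Complex.I * Real.pi * ((L.g v (phaseOf a z v) + 1 : ℝ) : ℂ)) := by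
    rw [evalAt_neg, hzs, Complex.ofReal_add, Complex.ofReal_one, mul_add, mul_one, Complex.exp_add,
      mul_comm Complex.I (Real.pi : ℂ), Complex.exp_pi_mul_I]
    ring
  obtain ⟨k, hk⟩ := ray_ext hs hr' (hzs'.symm.trans hzr')
  have h1 : L.g v (a v) < b v := (OrderIso.lt_symm_apply _).1 hab
  have h2 : b v < L.g v (a v) + 1 := by
    rw [← L.map_add_one v hv₁]
    exact (OrderIso.symm_apply_lt _).1 hba
  have h3 := (L.g v).lt_iff_lt.2 hθ.1
  have h4 := (L.g v).le_iff_le.2 hθ.2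
  rw [L.map_add_one v hv₁] at h4
  have hk0 : k = 0 := by
    have i1 : (-1 : ℝ) < k := by linarith [hθ'.2]
    have i2 : (k : ℝ) < 1 := by linarith [hθ'.1]
    have i1 : -1 < k := by exact_mod_cast i1
    have i2 : k < 1 := by exact_mod_cast i2
    omega
  rw [hk0, Int.cast_zero, mul_zero, add_zero] at hk
  refine ⟨(OrderIso.le_symm_apply _).2 (by linarith [hθ'.2]), ?_⟩
  rw [← hk]
  exact add_lt_add_left h3 1

end

/-! ### Triples of objects in a distinguished triangle -/

theorem isZero_shift_iff {D : Type u₁} [Category.{v₁} D] [Preadditive D] [HasShift D ℤ]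
    [∀ n : ℤ, (shiftFunctor D n).Additive] (X : D) (n : ℤ) : IsZero (X⟦n⟧) ↔ IsZero X := by
  refine ⟨fun h => ?_, fun h => (shiftFunctor D n).map_isZero h⟩
  exact ((shiftFunctor D (-n)).map_isZero h).of_iso ((shiftEquiv D n).unitIso.app X)

section

variable {D : Type u₁} [Category.{v₁} D] [Preadditive D] [HasZeroObject D] [HasShift D ℤ]
  [∀ n : ℤ, (shiftFunctor D n).Additive] [Pretriangulated D]

/-- The objects `X`, `Y`, `Z` are the vertices of a distinguished triangle. -/
def Tri (X Y Z : D) : Prop :=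
  ∃ (f : X ⟶ Y) (g : Y ⟶ Z) (h : Z ⟶ X⟦(1 : ℤ)⟧), Triangle.mk f g h ∈ distTriang D

theorem Tri.of_mem {T : Triangle D} (hT : T ∈ distTriang D) : Tri T.obj₁ T.obj₂ T.obj₃ :=
  ⟨T.mor₁, T.mor₂, T.mor₃, hT⟩

theorem Tri.of_iso {X Y Z X' Y' Z' : D} (h : Tri X Y Z) (e₁ : X ≅ X') (e₂ : Y ≅ Y')
    (e₃ : Z ≅ Z') : Tri X' Y' Z' := by
  obtain ⟨f, g, h, hT⟩ := h
  refine ⟨e₁.inv ≫ f ≫ e₂.hom, e₂.inv ≫ g ≫ e₃.hom, e₃.inv ≫ h ≫ e₁.hom⟦(1 : ℤ)⟧', ?_⟩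
  refine isomorphic_distinguished _ hT _ (Triangle.isoMk _ _ e₁.symm e₂.symm e₃.symm ?_ ?_ ?_)
  · change (e₁.inv ≫ f ≫ e₂.hom) ≫ e₂.inv = e₁.inv ≫ f
    simp
  · change (e₂.inv ≫ g ≫ e₃.hom) ≫ e₃.inv = e₂.inv ≫ g
    simp
  · change (e₃.inv ≫ h ≫ e₁.hom⟦(1 : ℤ)⟧') ≫ e₁.inv⟦(1 : ℤ)⟧' = e₃.inv ≫ h
    rw [Category.assoc, Category.assoc, ← Functor.map_comp, Iso.hom_inv_id, CategoryTheory.Functor.map_id,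
      Category.comp_id]

theorem Tri.rotate {X Y Z : D} (h : Tri X Y Z) : Tri Y Z (X⟦(1 : ℤ)⟧) := by
  obtain ⟨f, g, h, hT⟩ := h
  exact Tri.of_mem (rot_of_distTriang _ hT)

theorem Tri.invRotate {X Y Z : D} (h : Tri X Y Z) : Tri (Z⟦(-1 : ℤ)⟧) X Y := by
  obtain ⟨f, g, h, hT⟩ := h
  exact Tri.of_mem (inv_rot_of_distTriang _ hT)

theorem Tri.shift {X Y Z : D} (h : Tri X Y Z) (n : ℤ) : Tri (X⟦n⟧) (Y⟦n⟧) (Z⟦n⟧) := by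
  obtain ⟨f, g, h, hT⟩ := h
  exact Tri.of_mem (Triangle.shift_distinguished _ hT n)

theorem Tri.of_isZero₁ {X Y Z : D} (hX : IsZero X) (e : Y ≅ Z) : Tri X Y Z :=
  Tri.of_iso (Tri.of_mem (contractible_distinguished₁ Y)) ((isZero_zero D).iso hX) (Iso.refl _) e

theorem Tri.of_isZero₃ {X Y Z : D} (hZ : IsZero Z) (e : X ≅ Y) : Tri X Y Z :=
  Tri.of_iso (Tri.of_mem (contractible_distinguished X)) (Iso.refl _) e ((isZero_zero D).iso hZ)

theorem Tri.iso₂₃ {X Y Z : D} (h : Tri X Y Z) (hX : IsZero X) : Nonempty (Y ≅ Z) := by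
  obtain ⟨f, g, h, hT⟩ := h
  have : IsIso g := (Triangle.isZero₁_iff_isIso₂ _ hT).1 hX
  exact ⟨asIso g⟩

theorem Tri.iso₁₂ {X Y Z : D} (h : Tri X Y Z) (hZ : IsZero Z) : Nonempty (X ≅ Y) := by
  obtain ⟨f, g, h, hT⟩ := h
  have : IsIso f := (Triangle.isZero₃_iff_isIso₁ _ hT).1 hZ
  exact ⟨asIso f⟩

/-- Pulling back a triangle along a morphism to its third vertex. -/
theorem Tri.pullback [IsTriangulated D] {M E N N₀ N₁ : D} (h : Tri M E N) (h' : Tri N₀ N N₁) :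
    ∃ K, Tri M K N₀ ∧ Tri K E N₁ := by
  obtain ⟨f, g, δ, hT⟩ := h
  obtain ⟨f', g', δ', hT'⟩ := h'
  obtain ⟨K, i, w, hK⟩ := distinguished_cocone_triangle₁ (g ≫ g')
  exact ⟨K, Tri.of_mem (someOctahedron' rfl hT hT' hK).mem, Tri.of_mem hK⟩

/-- Pushing out a triangle along a morphism from its first vertex. -/
theorem Tri.pushout [IsTriangulated D] {M E N M₀ M₁ : D} (h : Tri M E N) (h' : Tri M₀ M M₁) :
    ∃ C, Tri M₀ E C ∧ Tri M₁ C N := by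
  obtain ⟨f, g, δ, hT⟩ := h
  obtain ⟨f', g', δ', hT'⟩ := h'
  obtain ⟨C, i, w, hC⟩ := distinguished_cocone_triangle (f' ≫ f)
  exact ⟨C, Tri.of_mem hC, Tri.of_mem (someOctahedron rfl hT' hT hC).mem⟩

/-! ### Bounds for a t-structure along triangles. -/

section TStructure

variable (t : TStructure D)

theorem heart_iff (X : D) : t.heart X ↔ t.IsLE X 0 ∧ t.IsGE X 0 := t.mem_heart_iff X

theorem heart_of_iso {X Y : D} (e : X ≅ Y) (h : t.heart X) : t.heart Y :=
  t.heart.prop_of_iso e h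

variable {t}

theorem Tri.isLE₂ [IsTriangulated D] {X Y Z : D} (h : Tri X Y Z) (n : ℤ) (h₁ : t.IsLE X n)
    (h₃ : t.IsLE Z n) : t.IsLE Y n := by
  obtain ⟨f, g, h, hT⟩ := h
  exact t.isLE₂ _ hT n h₁ h₃

theorem Tri.isGE₂ [IsTriangulated D] {X Y Z : D} (h : Tri X Y Z) (n : ℤ) (h₁ : t.IsGE X n)
    (h₃ : t.IsGE Z n) : t.IsGE Y n := by
  obtain ⟨f, g, h, hT⟩ := h
  exact t.isGE₂ _ hT n h₁ h₃

theorem Tri.isLE₃ [IsTriangulated D] {X Y Z : D} (h : Tri X Y Z) (n : ℤ) (h₁ : t.IsLE X (n + 1))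
    (h₂ : t.IsLE Y n) : t.IsLE Z n :=
  h.rotate.isLE₂ n h₂ (t.isLE_shift X (n + 1) 1 n)

theorem Tri.isGE₃ [IsTriangulated D] {X Y Z : D} (h : Tri X Y Z) (n : ℤ) (h₁ : t.IsGE X (n + 1))
    (h₂ : t.IsGE Y n) : t.IsGE Z n :=
  h.rotate.isGE₂ n h₂ (t.isGE_shift X (n + 1) 1 n)

theorem Tri.isGE₁ [IsTriangulated D] {X Y Z : D} (h : Tri X Y Z) (n : ℤ) (h₂ : t.IsGE Y n)
    (h₃ : t.IsGE Z (n - 1)) : t.IsGE X n :=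
  h.invRotate.isGE₂ n (t.isGE_shift Z (n - 1) (-1) n) h₂

theorem Tri.heart₂ [IsTriangulated D] {X Y Z : D} (h : Tri X Y Z) (h₁ : t.heart X)
    (h₃ : t.heart Z) : t.heart Y := by
  rw [heart_iff] at *
  exact ⟨h.isLE₂ 0 h₁.1 h₃.1, h.isGE₂ 0 h₁.2 h₃.2⟩

theorem heart_of_isZero {X : D} (h : IsZero X) : t.heart X :=
  (heart_iff t X).2 ⟨t.isLE_of_isZero h 0, t.isGE_of_isZero h 0⟩

/-- Such an object lies both in degrees ≤ 0 and in degrees ≥ 1. -/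
theorem isZero_of_heart_shift {X : D} (h : t.heart X) (h' : t.heart (X⟦(1 : ℤ)⟧)) :
    IsZero X := by
  have h1 := ((heart_iff _ _).1 h).1
  have h2 := ((heart_iff _ _).1 h').2
  have h3 : t.IsGE X 1 := t.isGE_of_shift X 1 1 0
  exact t.isZero X 0 1

theorem isZero_iff_obj (X : HeartCat t) : IsZero X ↔ IsZero X.obj := by
  rw [IsZero.iff_id_eq_zero, IsZero.iff_id_eq_zero]
  constructor
  · intro h
    exact congrArg (t.heart.ι.map) h
  · intro h
    exact t.heart.ι.map_injective h

end TStructure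

end

/-! ### Short exact sequences in the heart -/

noncomputable section

variable {D : Type u₁} [Category.{v₁} D] [Preadditive D] [HasZeroObject D] [HasShift D ℤ]
  [∀ n : ℤ, (shiftFunctor D n).Additive] [Pretriangulated D] (t : TStructure D)

theorem heart_hom_shift_neg ⦃X Y : HeartCat t⦄ ⦃n : ℤ⦄ (f : t.heart.ι.obj X ⟶ (t.heart.ι.obj Y)⟦n⟧)
    (hn : n < 0) : f = 0 := by
  have hX := ((heart_iff t _).1 X.2).1
  have hY := ((heart_iff t _).1 Y.2).2
  exact t.zero_of_isLE_of_isGE f 0 (-n) (by omega) hX (t.isGE_shift Y.obj 0 n (-n))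

variable [IsTriangulated D]

/-- The cone of a morphism in the heart lives in degrees [-1,0]; its truncation triangle displays
the kernel, shifted by 1, and the cokernel. -/
theorem heart_admissible : AbelianSubcategory.admissibleMorphism t.heart.ι = ⊤ := by
  ext X₁ X₂ f
  refine ⟨fun _ => trivial, fun _ => ?_⟩
  intro X₃ f₂ f₃ hT
  have h : Tri X₁.obj X₂.obj X₃ := ⟨_, _, _, hT⟩
  have h₁ := (heart_iff t _).1 X₁.2
  have h₂ := (heart_iff t _).1 X₂.2
  have hle : t.IsLE X₃ 0 := h.isLE₃ 0 (by have := h₁.1; exact t.isLE_of_le _ 0 _) h₂.1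
  have hge : t.IsGE X₃ (-1) :=
    h.isGE₃ (-1) h₁.2 (by have := h₂.2; exact t.isGE_of_ge _ _ 0)
  obtain ⟨A, B, hA, hB, α, β, γ, hT'⟩ := t.exists_triangle X₃ (-1) 0 (by norm_num)
  have hA : t.IsLE A (-1) := ⟨hA⟩
  have hB : t.IsGE B 0 := ⟨hB⟩
  have h' : Tri A X₃ B := ⟨_, _, _, hT'⟩
  have hA' : t.IsGE A (-1) := h'.isGE₁ (-1) hge (t.isGE_of_ge _ _ 0)
  have hB' : t.IsLE B 0 := h'.isLE₃ 0 (t.isLE_of_le _ (-1) _) hle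
  let K : HeartCat t := ⟨A⟦(-1 : ℤ)⟧, (heart_iff t _).2
    ⟨t.isLE_shift A (-1) (-1) 0, t.isGE_shift A (-1) (-1) 0⟩⟩
  let Q : HeartCat t := ⟨B, (heart_iff t _).2 ⟨hB', hB⟩⟩
  let e : (K.obj)⟦(1 : ℤ)⟧ ≅ A := (shiftEquiv D (1 : ℤ)).counitIso.app A
  refine ⟨K, Q, e.hom ≫ α, β, γ ≫ e.inv⟦(1 : ℤ)⟧', ?_⟩
  refine isomorphic_distinguished _ hT' _ (Triangle.isoMk _ _ e (Iso.refl _) (Iso.refl _) ?_ ?_ ?_)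
  · change (e.hom ≫ α) ≫ 𝟙 _ = e.hom ≫ α
    simp
  · change β ≫ 𝟙 _ = 𝟙 _ ≫ β
    simp
  · change (γ ≫ e.inv⟦(1 : ℤ)⟧') ≫ e.hom⟦(1 : ℤ)⟧' = 𝟙 _ ≫ γ
    rw [Category.assoc, ← Functor.map_comp, Iso.inv_hom_id, CategoryTheory.Functor.map_id,
      Category.comp_id, Category.id_comp]

instance : HasZeroObject (HeartCat t) :=
  have ⟨Z, hZ⟩ := HasZeroObject.zero (C := D)
  ⟨⟨Z, heart_of_isZero hZ⟩, (isZero_iff_obj _).2 hZ⟩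

instance : HasBinaryBiproducts (HeartCat t) where
  has_binary_biproduct X Y := by
    have h : t.heart (X.obj ⊞ Y.obj) :=
      (Tri.of_mem (binaryBiproductTriangle_distinguished X.obj Y.obj)).heart₂ X.2 Y.2
    refine hasBinaryBiproduct_of_total
      { pt := ⟨X.obj ⊞ Y.obj, h⟩
        fst := t.heart.fullyFaithfulι.preimage (biprod.fst : X.obj ⊞ Y.obj ⟶ _)
        snd := t.heart.fullyFaithfulι.preimage (biprod.snd : X.obj ⊞ Y.obj ⟶ _)
        inl := t.heart.fullyFaithfulι.preimage (biprod.inl : _ ⟶ X.obj ⊞ Y.obj)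
        inr := t.heart.fullyFaithfulι.preimage (biprod.inr : _ ⟶ X.obj ⊞ Y.obj)
        inl_fst := t.heart.ι.map_injective (biprod.inl_fst (X := X.obj) (Y := Y.obj))
        inl_snd := t.heart.ι.map_injective (biprod.inl_snd (X := X.obj) (Y := Y.obj))
        inr_fst := t.heart.ι.map_injective (biprod.inr_fst (X := X.obj) (Y := Y.obj))
        inr_snd := t.heart.ι.map_injective (biprod.inr_snd (X := X.obj) (Y := Y.obj)) }
      (t.heart.ι.map_injective (biprod.total (X := X.obj) (Y := Y.obj)))

instance : HasFiniteProducts (HeartCat t) :=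
  have : HasTerminal (HeartCat t) := HasZeroObject.hasTerminal
  hasFiniteProducts_of_has_binary_and_terminal

instance : Abelian (HeartCat t) :=
  AbelianSubcategory.abelian t.heart.ι (heart_hom_shift_neg t) (heart_admissible t)

variable {t}

/-- Together with `exists_shortExact_of_tri` this identifies exact sequences in a heart with
triangles having all vertices there. Two hearts can then be compared using triangles of `D` alone.
-/
theorem tri_of_shortExact {S : ShortComplex (HeartCat t)} (hS : S.ShortExact) :
    Tri S.X₁.obj S.X₂.obj S.X₃.obj := by
  have := hS.epi_g
  have := hS.mono_f
  obtain ⟨K, i, δ, hT⟩ := AbelianSubcategory.exists_distinguished_triangle_of_epi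
    (heart_hom_shift_neg t) (heart_admissible t) S.g
  have hK := AbelianSubcategory.isLimitKernelForkOfDistTriang (heart_hom_shift_neg t) i S.g δ hT
  let e : K ≅ S.X₁ := IsLimit.conePointUniqueUpToIso hK hS.fIsKernel
  exact Tri.of_iso ⟨_, _, _, hT⟩ (t.heart.ι.mapIso e) (Iso.refl _) (Iso.refl _)

theorem exists_shortExact_of_tri {X Y Z : HeartCat t} (h : Tri X.obj Y.obj Z.obj) :
    ∃ (f : X ⟶ Y) (g : Y ⟶ Z) (w : f ≫ g = 0), (ShortComplex.mk f g w).ShortExact := by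
  obtain ⟨f, g, δ, hT⟩ := h
  let f' : X ⟶ Y := t.heart.fullyFaithfulι.preimage f
  let g' : Y ⟶ Z := t.heart.fullyFaithfulι.preimage g
  have hT' : Triangle.mk (t.heart.ι.map f') (t.heart.ι.map g') δ ∈ distTriang D := hT
  have hK := AbelianSubcategory.isLimitKernelForkOfDistTriang (heart_hom_shift_neg t) f' g' δ hT'
  have hC := AbelianSubcategory.isColimitCokernelCoforkOfDistTriang
    (heart_hom_shift_neg t) f' g' δ hT'
  have w : f' ≫ g' = 0 := t.heart.ι.map_injective (comp_distTriang_mor_zero₁₂ _ hT)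
  exact ⟨f', g', w, ShortComplex.ShortExact.mk' (ShortComplex.exact_of_f_is_kernel _ hK)
    (mono_of_isLimit_fork hK) (epi_of_isColimit_cofork hC)⟩

end

/-! ### Harder–Narasimhan filtrations and tilting in a triangulated category -/

section

variable {D : Type u₁} [Category.{v₁} D] [Preadditive D] [HasZeroObject D] [HasShift D ℤ]
  [∀ n : ℤ, (shiftFunctor D n).Additive] [Pretriangulated D]

/-- Semistability in the heart of `t` with respect to a phase `φ`, in terms of triangles. -/
def TriSemistable (t : TStructure D) (φ : D → ℝ → ℝ) (E : D) : Prop :=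
  t.heart E ∧ ¬ IsZero E ∧ ∀ M N : D, Tri M E N → t.heart M → t.heart N →
    ¬ IsZero M → ¬ IsZero N → PhaseLE (φ M) (φ N)

/-- The weak seesaw property in the heart of `t`, in terms of triangles. -/
def TriSeesaw (t : TStructure D) (φ : D → ℝ → ℝ) : Prop :=
  ∀ X Y Z : D, Tri X Y Z → t.heart X → t.heart Y → t.heart Z →
    ¬ IsZero X → ¬ IsZero Y → ¬ IsZero Z →
    (PhaseLE (φ X) (φ Y) ∧ PhaseLE (φ Y) (φ Z)) ∨ (PhaseLE (φ Y) (φ X) ∧ PhaseLE (φ Z) (φ Y))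

/-- The phase `φ` of nonzero objects of the heart of `t` is invariant under isomorphisms. -/
def PhaseInvariant (t : TStructure D) (φ : D → ℝ → ℝ) : Prop :=
  ∀ X Y : D, Nonempty (X ≅ Y) → t.heart X → ¬ IsZero X → φ X =ᶠ[atTop] φ Y

/-- `E` has a Harder–Narasimhan filtration with the given factors, listed from the top to the
bottom. -/
inductive HNSeq (t : TStructure D) (φ : D → ℝ → ℝ) : D → List D → Prop
  | nil {E : D} (h : IsZero E) : HNSeq t φ E []
  | cons {E' E Q : D} {l : List D} (h : HNSeq t φ E' l) (hT : Tri E' E Q)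
      (hQ : TriSemistable t φ Q) (hl : ∀ Q' ∈ l, PhaseLT (φ Q) (φ Q')) : HNSeq t φ E (Q :: l)

variable {t : TStructure D} {φ : D → ℝ → ℝ}

theorem HNSeq.semistable {E : D} {l : List D} (h : HNSeq t φ E l) :
    ∀ Q ∈ l, TriSemistable t φ Q := by
  induction h with
  | nil => simp
  | cons h hT hQ hl ih =>
    intro Q' hQ'
    rcases List.mem_cons.1 hQ' with rfl | hQ'
    · exact hQ
    · exact ih _ hQ'

theorem HNSeq.heart [IsTriangulated D] {E : D} {l : List D} (h : HNSeq t φ E l) :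
    t.heart E := by
  induction h with
  | nil h => exact heart_of_isZero h
  | cons h hT hQ hl ih => exact hT.heart₂ ih hQ.1

theorem HNSeq.of_iso {E E' : D} {l : List D} (h : HNSeq t φ E l) (e : E ≅ E') :
    HNSeq t φ E' l := by
  cases h with
  | nil h => exact .nil (h.of_iso e.symm)
  | cons h hT hQ hl => exact .cons h (hT.of_iso (Iso.refl _) e (Iso.refl _)) hQ hl

/-- Induction on the filtration of the quotient: its penultimate step is pulled back to `E` by the
octahedral axiom, giving an extension of that step by `E₀`. -/
theorem HNSeq.append [IsTriangulated D] {E₀ E₁ : D} {l₀ l₁ : List D} (h₀ : HNSeq t φ E₀ l₀)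
    (h₁ : HNSeq t φ E₁ l₁) (h : ∀ Q₁ ∈ l₁, ∀ Q₀ ∈ l₀, PhaseLT (φ Q₁) (φ Q₀)) :
    ∀ {E : D}, Tri E₀ E E₁ → HNSeq t φ E (l₁ ++ l₀) := by
  induction h₁ with
  | nil hz =>
    intro E hE
    exact h₀.of_iso (hE.iso₁₂ hz).some
  | @cons E' E₁ Q l h₁ hT hQ hl ih =>
    intro E hE
    obtain ⟨K, hK, hK'⟩ := hE.pullback hT
    refine .cons (ih (fun Q₁ hQ₁ => h Q₁ (List.mem_cons_of_mem _ hQ₁)) hK) hK' hQ ?_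
    intro Q' hQ'
    rcases List.mem_append.1 hQ' with hQ' | hQ'
    · exact hl _ hQ'
    · exact h Q List.mem_cons_self _ hQ'

section Seesaw

variable (hs : TriSeesaw t φ) (hi : PhaseInvariant t φ) {X Y Z : D} (hT : Tri X Y Z)
  (hX : t.heart X) (hY : t.heart Y) (hZ : t.heart Z)

include hs hi hT hX hY hZ

/-- In this and the next three lemmas a strict inequality between the outer phases excludes one of
the two seesaw alternatives. It is required only if the third vertex is nonzero; otherwise the other
two are isomorphic and their phases agree. -/
theorem TriSeesaw.middle_le_right (hY0 : ¬ IsZero Y) (hZ0 : ¬ IsZero Z)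
    (h : ¬ IsZero X → PhaseLT (φ X) (φ Z)) : PhaseLE (φ Y) (φ Z) := by
  by_cases hX0 : IsZero X
  · exact .of_eventuallyEq (hi _ _ (hT.iso₂₃ hX0) hY hY0)
  · rcases hs _ _ _ hT hX hY hZ hX0 hY0 hZ0 with h' | h'
    · exact h'.2
    · exact absurd (h'.2.trans h'.1) (h hX0).not_le

theorem TriSeesaw.right_le_middle (hY0 : ¬ IsZero Y) (hZ0 : ¬ IsZero Z)
    (h : ¬ IsZero X → PhaseLT (φ Z) (φ X)) : PhaseLE (φ Z) (φ Y) := by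
  by_cases hX0 : IsZero X
  · exact .of_eventuallyEq (hi _ _ (hT.iso₂₃ hX0) hY hY0).symm
  · rcases hs _ _ _ hT hX hY hZ hX0 hY0 hZ0 with h' | h'
    · exact absurd (h'.1.trans h'.2) (h hX0).not_le
    · exact h'.2

theorem TriSeesaw.middle_le_left (hX0 : ¬ IsZero X) (hY0 : ¬ IsZero Y)
    (h : ¬ IsZero Z → PhaseLT (φ Z) (φ X)) : PhaseLE (φ Y) (φ X) := by
  by_cases hZ0 : IsZero Z
  · exact .of_eventuallyEq (hi _ _ (hT.iso₁₂ hZ0) hX hX0).symm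
  · rcases hs _ _ _ hT hX hY hZ hX0 hY0 hZ0 with h' | h'
    · exact absurd (h'.1.trans h'.2) (h hZ0).not_le
    · exact h'.1

theorem TriSeesaw.left_le_middle (hX0 : ¬ IsZero X) (hY0 : ¬ IsZero Y)
    (h : ¬ IsZero Z → PhaseLT (φ X) (φ Z)) : PhaseLE (φ X) (φ Y) := by
  by_cases hZ0 : IsZero Z
  · exact .of_eventuallyEq (hi _ _ (hT.iso₁₂ hZ0) hX hX0)
  · rcases hs _ _ _ hT hX hY hZ hX0 hY0 hZ0 with h' | h'
    · exact h'.1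
    · exact absurd (h'.2.trans h'.1) (h hZ0).not_le

end Seesaw

/-! ### Amplitude estimates between two t-structures. -/

section Bounded

variable [IsTriangulated D] {t₁ t₂ : TStructure D}
  (h : ∀ E : D, t₁.heart E → t₂.IsGE E 0 ∧ t₂.IsLE E 1)

include h

/-- Dévissage on the width n: truncation splits off the lowest cohomology object, a shift of an
object of the heart. -/
theorem amplitude_of_heart_amplitude (n : ℕ) : ∀ (k : ℤ) (X : D), t₁.IsGE X k →
    t₁.IsLE X (k + n) → t₂.IsGE X k ∧ t₂.IsLE X (k + n + 1) := by
  have hzero : ∀ (k : ℤ) (X : D), t₁.IsGE X k → t₁.IsLE X k →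
      t₂.IsGE X k ∧ t₂.IsLE X (k + 1) := by
    intro k X hX hX'
    obtain ⟨h0, h1⟩ := h (X⟦k⟧) ((heart_iff _ _).2
      ⟨t₁.isLE_shift X k k 0, t₁.isGE_shift X k k 0⟩)
    exact ⟨t₂.isGE_of_shift X k k 0, t₂.isLE_of_shift X (k + 1) k 1⟩
  induction n with
  | zero =>
    intro k X hX hX'
    simpa using hzero k X hX (by simpa using hX')
  | succ n ih =>
    intro k X hX hX'
    push_cast at hX' ⊢
    obtain ⟨A, B, hA, hB, f, g, w, hT⟩ := t₁.exists_triangle X k (k + 1) rfl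
    replace hT : Tri A X B := ⟨_, _, _, hT⟩
    have hA : t₁.IsLE A k := ⟨hA⟩
    have hB : t₁.IsGE B (k + 1) := ⟨hB⟩
    have hA' : t₁.IsGE A k := hT.isGE₁ k hX (t₁.isGE_of_ge _ _ (k + 1))
    have hB' : t₁.IsLE B (k + 1 + n) :=
      hT.isLE₃ _ (t₁.isLE_of_le _ k _) (t₁.isLE_of_le _ (k + (n + 1)) _)
    obtain ⟨a1, a2⟩ := hzero k A hA' hA
    obtain ⟨b1, b2⟩ := ih (k + 1) B hB hB'
    exact ⟨hT.isGE₂ k a1 (t₂.isGE_of_ge _ _ (k + 1)),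
      hT.isLE₂ _ (t₂.isLE_of_le _ (k + 1) _) (t₂.isLE_of_le _ (k + 1 + n + 1) _)⟩

/-- Boundedness extends the amplitude bound from the heart to the inclusions `hge` and `hle` of
half-planes of the t-structures; taking orthogonals reverses them. -/
theorem heart_amplitude_of_bounded (hb : ∀ X : D, t₁.bounded X) (E : D) (hE : t₂.heart E) :
    t₁.IsGE E (-1) ∧ t₁.IsLE E 0 := by
  obtain ⟨hE1, hE2⟩ := (heart_iff _ _).1 hE
  have hge : ∀ (k : ℤ) (Y : D), t₁.IsGE Y k → t₂.IsGE Y k := by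
    intro k Y hY
    obtain ⟨m, hm⟩ := (hb Y).2
    -- If m < k, the width becomes 0, which is harmless because degrees ≤ m are then degrees ≤ k.
    exact (amplitude_of_heart_amplitude h (m - k).toNat k Y hY (t₁.isLE_of_le _ m _)).1
  have hle : ∀ (k : ℤ) (Y : D), t₁.IsLE Y k → t₂.IsLE Y (k + 1) := by
    intro k Y hY
    obtain ⟨m, hm⟩ := (hb Y).1
    -- The lower bound m may exceed k; taking the minimum keeps the width k - min m k nonnegative.
    have hm' : t₁.IsGE Y (min m k) := t₁.isGE_of_ge _ _ m
    have := (amplitude_of_heart_amplitude h (k - min m k).toNat _ Y hm'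
      (t₁.isLE_of_le _ k _)).2
    exact t₂.isLE_of_le _ (min m k + (k - min m k).toNat + 1) _
  constructor
  · rw [t₁.isGE_iff_orthogonal (-2) (-1) (by norm_num)]
    intro Y f hY
    exact t₂.zero_of_isLE_of_isGE f (-1) 0 (by norm_num) (hle (-2) Y hY) hE2
  · rw [t₁.isLE_iff_orthogonal 0 1 (by norm_num)]
    intro Y f hY
    exact t₂.zero_of_isLE_of_isGE f 0 1 (by norm_num) hE1 (hge 1 Y hY)

end Bounded

/-- Two hearts, one a tilt of the other, with phases for which the torsion pairs are cut out by the
phases `c` and `d`, and which are ordered in the same way on the torsion and torsion-free objects. -/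
structure TiltedPhases (t₁ t₂ : TStructure D) (φ₁ φ₂ : D → ℝ → ℝ) (c d : ℝ → ℝ) : Prop where
  amplitude : ∀ E : D, t₁.heart E → t₂.IsGE E 0 ∧ t₂.IsLE E 1
  amplitude' : ∀ E : D, t₂.heart E → t₁.IsGE E (-1) ∧ t₁.IsLE E 0
  invariant₁ : PhaseInvariant t₁ φ₁
  invariant₂ : PhaseInvariant t₂ φ₂
  seesaw₁ : TriSeesaw t₁ φ₁
  seesaw₂ : TriSeesaw t₂ φ₂
  cut₀ : ∀ X : D, t₁.heart X → t₂.heart X → ¬ IsZero X → PhaseLT c (φ₁ X) ∧ PhaseLE (φ₂ X) d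
  cut₁ : ∀ X : D, t₁.heart X → t₂.heart (X⟦(1 : ℤ)⟧) → ¬ IsZero X →
    PhaseLE (φ₁ X) c ∧ PhaseLT d (φ₂ (X⟦(1 : ℤ)⟧))
  mono₀ : ∀ X Y : D, t₁.heart X → t₂.heart X → t₁.heart Y → t₂.heart Y → ¬ IsZero X → ¬ IsZero Y →
    (PhaseLT (φ₁ X) (φ₁ Y) → PhaseLT (φ₂ X) (φ₂ Y)) ∧
    (PhaseLE (φ₁ X) (φ₁ Y) → PhaseLE (φ₂ X) (φ₂ Y))
  mono₁ : ∀ X Y : D, t₁.heart X → t₂.heart (X⟦(1 : ℤ)⟧) → t₁.heart Y → t₂.heart (Y⟦(1 : ℤ)⟧) →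
    ¬ IsZero X → ¬ IsZero Y →
    (PhaseLT (φ₁ X) (φ₁ Y) → PhaseLT (φ₂ (X⟦(1 : ℤ)⟧)) (φ₂ (Y⟦(1 : ℤ)⟧))) ∧
    (PhaseLE (φ₁ X) (φ₁ Y) → PhaseLE (φ₂ (X⟦(1 : ℤ)⟧)) (φ₂ (Y⟦(1 : ℤ)⟧)))

/-! ### Transfer of semistability and HN filtrations across the tilt. -/

namespace TiltedPhases

variable [IsTriangulated D] {t₁ t₂ : TStructure D} {φ₁ φ₂ : D → ℝ → ℝ} {c d : ℝ → ℝ}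
  (P : TiltedPhases t₁ t₂ φ₁ φ₂ c d)

include P

theorem exists_tri₁ {E : D} (hE : t₁.heart E) : ∃ X₀ X₁ : D, Tri X₀ E X₁ ∧ t₁.heart X₀ ∧
    t₂.heart X₀ ∧ t₁.heart X₁ ∧ t₂.heart (X₁⟦(1 : ℤ)⟧) := by
  obtain ⟨A, B, hA, hB, f, g, w, hT⟩ := t₂.exists_triangle E 0 1 (by norm_num)
  replace hT : Tri A E B := ⟨_, _, _, hT⟩
  have hA : t₂.IsLE A 0 := ⟨hA⟩
  have hB : t₂.IsGE B 1 := ⟨hB⟩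
  obtain ⟨e1, e2⟩ := P.amplitude E hE
  obtain ⟨e3, e4⟩ := (heart_iff _ _).1 hE
  have hA2 : t₂.heart A := (heart_iff _ _).2 ⟨hA, hT.isGE₁ 0 e1 (t₂.isGE_of_ge _ _ 1)⟩
  have hB' : t₂.IsLE B 1 := hT.isLE₃ 1 (t₂.isLE_of_le _ 0 _) e2
  have hB2 : t₂.heart (B⟦(1 : ℤ)⟧) :=
    (heart_iff _ _).2 ⟨t₂.isLE_shift B 1 1 0, t₂.isGE_shift B 1 1 0⟩
  obtain ⟨a1, a2⟩ := P.amplitude' A hA2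
  obtain ⟨b1, b2⟩ := P.amplitude' _ hB2
  have b3 : t₁.IsGE B 0 := t₁.isGE_of_shift B 0 1 (-1)
  refine ⟨A, B, hT, (heart_iff _ _).2 ⟨a2, hT.isGE₁ 0 e4 (t₁.isGE_of_ge _ _ 0)⟩, hA2,
    (heart_iff _ _).2 ⟨hT.isLE₃ 0 (t₁.isLE_of_le _ 0 _) e3, b3⟩, hB2⟩

theorem exists_tri₂ {F : D} (hF : t₂.heart F) : ∃ Y₁ Y₀ : D, Tri (Y₁⟦(1 : ℤ)⟧) F Y₀ ∧
    t₁.heart Y₁ ∧ t₂.heart (Y₁⟦(1 : ℤ)⟧) ∧ t₁.heart Y₀ ∧ t₂.heart Y₀ := by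
  obtain ⟨A, B, hA, hB, f, g, w, hT⟩ := t₁.exists_triangle F (-1) 0 (by norm_num)
  replace hT : Tri (A⟦(-1 : ℤ)⟧⟦(1 : ℤ)⟧) F B := Tri.of_iso ⟨_, _, _, hT⟩
    ((shiftEquiv D (1 : ℤ)).counitIso.app A).symm (Iso.refl _) (Iso.refl _)
  have hA : t₁.IsLE (A⟦(-1 : ℤ)⟧) 0 := by
    have : t₁.IsLE A (-1) := ⟨hA⟩
    exact t₁.isLE_shift A (-1) (-1) 0
  have hB : t₁.IsGE B 0 := ⟨hB⟩
  generalize A⟦(-1 : ℤ)⟧ = A at hT hA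
  obtain ⟨e1, e2⟩ := P.amplitude' F hF
  obtain ⟨e3, e4⟩ := (heart_iff _ _).1 hF
  have hB1 : t₁.heart B := by
    refine (heart_iff _ _).2 ⟨hT.isLE₃ 0 ?_ e2, hB⟩
    have := t₁.isLE_shift A 0 1 (-1)
    exact t₁.isLE_of_le _ (-1) _
  have hA1 : t₁.heart A := by
    have : t₁.IsGE (A⟦(1 : ℤ)⟧) (-1) := hT.isGE₁ (-1) e1 (t₁.isGE_of_ge _ _ 0)
    exact (heart_iff _ _).2 ⟨hA, t₁.isGE_of_shift A 0 1 (-1)⟩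
  obtain ⟨a1, a2⟩ := P.amplitude A hA1
  obtain ⟨b1, b2⟩ := P.amplitude B hB1
  have a3 : t₂.IsLE (A⟦(1 : ℤ)⟧) 0 := t₂.isLE_shift A 1 1 0
  have a4 : t₂.IsGE (A⟦(1 : ℤ)⟧) (-1) := t₂.isGE_shift A 0 1 (-1)
  exact ⟨A, B, hT, hA1, (heart_iff _ _).2 ⟨a3, hT.isGE₁ 0 e4 (t₂.isGE_of_ge _ _ 0)⟩, hB1,
    (heart_iff _ _).2 ⟨hT.isLE₃ 0 (t₂.isLE_of_le _ 0 _) e3, b1⟩⟩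

/-- If both parts were nonzero, semistability would give φ₁(X₀) ≼ φ₁(X₁) ≼ c ≺ φ₁(X₀). -/
theorem heart_or_heart_shift {E : D} (hE : TriSemistable t₁ φ₁ E) :
    t₂.heart E ∨ t₂.heart (E⟦(1 : ℤ)⟧) := by
  obtain ⟨X₀, X₁, hT, h01, h02, h11, h12⟩ := P.exists_tri₁ hE.1
  by_cases h0 : IsZero X₀
  · exact .inr (heart_of_iso _ ((shiftFunctor D (1 : ℤ)).mapIso (hT.iso₂₃ h0).some.symm) h12)
  by_cases h1 : IsZero X₁
  · exact .inl (heart_of_iso _ (hT.iso₁₂ h1).some h02)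
  exact absurd ((hE.2.2 _ _ hT h01 h11 h0 h1).trans (P.cut₁ _ h11 h12 h1).1)
    (P.cut₀ _ h01 h02 h0).1.not_le

/-- Let Y₁[1] → N → Y₀ be the decomposition of N. The image K in the first heart of M → G fits into
exact sequences Y₁ → M → K and K → G → Y₀ there. Hence φ₁(M) ≼ φ₁(K) ≼ φ₁(Y₀), which becomes φ₂(M) ≼
φ₂(Y₀) ≼ φ₂(N); the outer steps are seesaws across c and d. -/
theorem semistable₀ {G : D} (hG : TriSemistable t₁ φ₁ G) (hG2 : t₂.heart G) :
    TriSemistable t₂ φ₂ G := by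
  refine ⟨hG2, hG.2.1, fun M N hT hM hN hM0 hN0 => ?_⟩
  obtain ⟨g1, g2⟩ := (heart_iff _ _).1 hG.1
  have hM1 : t₁.heart M :=
    (heart_iff _ _).2 ⟨(P.amplitude' M hM).2, hT.isGE₁ 0 g2 (P.amplitude' N hN).1⟩
  obtain ⟨Y₁, Y₀, hN', h11, h12, h01, h02⟩ := P.exists_tri₂ hN
  have hY₁ : ¬ IsZero Y₁ → ¬ IsZero (Y₁⟦(1 : ℤ)⟧) := fun h h' => h ((isZero_shift_iff _ _).1 h')
  -- If Y₀ = 0, then M and N lie on opposite sides of d.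
  by_cases h0 : IsZero Y₀
  · have e := (hN'.iso₁₂ h0).some
    have h1 : ¬ IsZero Y₁ := fun h => hN0 (((isZero_shift_iff _ _).2 h).of_iso e.symm)
    exact ((P.cut₀ _ hM1 hM hM0).2.trans (P.cut₁ _ h11 h12 h1).2.le).trans
      (.of_eventuallyEq (P.invariant₂ _ _ ⟨e⟩ h12 (hY₁ h1)))
  obtain ⟨K, hK, hK'⟩ := hT.pullback hN'
  have hK2 : t₂.heart K := hK.heart₂ hM h12
  have hK1 : t₁.heart K := by
    refine (heart_iff _ _).2 ⟨hK.isLE₂ 0 ((heart_iff _ _).1 hM1).1 ?_,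
      hK'.isGE₁ 0 g2 (P.amplitude' Y₀ h02).1⟩
    exact (P.amplitude' _ h12).2
  -- If K = 0, then M ≅ Y₁ would be both torsion and torsion-free.
  have hK0 : ¬ IsZero K := by
    intro h
    have e : Y₁ ≅ M :=
      (shiftFunctor D (1 : ℤ)).preimageIso (hK.rotate.iso₂₃ h).some
    exact hM0 (isZero_of_heart_shift hM
      (heart_of_iso _ ((shiftFunctor D (1 : ℤ)).mapIso e) h12))
  have hMK : Tri Y₁ M K :=
    hK.invRotate.of_iso ((shiftEquiv D (1 : ℤ)).unitIso.app Y₁).symm (Iso.refl _) (Iso.refl _)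
  have hMK' := P.seesaw₁.middle_le_right P.invariant₁ hMK h11 hM1 hK1 hM0 hK0 fun h =>
    (P.cut₁ _ h11 h12 h).1.trans_lt (P.cut₀ _ hK1 hK2 hK0).1
  have hKY := hG.2.2 _ _ hK' hK1 h01 hK0 h0
  refine ((P.mono₀ _ _ hM1 hM h01 h02 hM0 h0).2 (hMK'.trans hKY)).trans ?_
  exact P.seesaw₂.right_le_middle P.invariant₂ hN' h12 hN h02 hN0 h0 fun h =>
    (P.cut₀ _ h01 h02 h0).2.trans_lt
      (P.cut₁ _ h11 h12 fun h' => h ((isZero_shift_iff _ _).2 h')).2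

/-- Dual to `semistable₀`: now the subobject M is decomposed as Y₁[1] → M → Y₀. The image C of G → N
in the first heart gives exact sequences Y₁ → G → C and C → N → Y₀ there, so φ₁(Y₁) ≼ φ₁(C) ≼ φ₁(N),
and φ₂(M) ≼ φ₂(Y₁[1]) ≼ φ₂(N[1]). -/
theorem semistable₁ {G : D} (hG : TriSemistable t₁ φ₁ G) (hG2 : t₂.heart (G⟦(1 : ℤ)⟧)) :
    TriSemistable t₂ φ₂ (G⟦(1 : ℤ)⟧) := by
  refine ⟨hG2, fun h => hG.2.1 ((isZero_shift_iff _ _).1 h), fun M N' hT hM hN' hM0 hN0' => ?_⟩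
  obtain ⟨g1, g2⟩ := (heart_iff _ _).1 hG.1
  have g3 : t₁.IsLE (G⟦(1 : ℤ)⟧) (-1) := t₁.isLE_shift G 0 1 (-1)
  obtain ⟨N, ⟨e⟩⟩ : ∃ N : D, Nonempty (N⟦(1 : ℤ)⟧ ≅ N') :=
    ⟨N'⟦(-1 : ℤ)⟧, ⟨(shiftEquiv D (1 : ℤ)).counitIso.app N'⟩⟩
  replace hT : Tri M (G⟦(1 : ℤ)⟧) (N⟦(1 : ℤ)⟧) := hT.of_iso (Iso.refl _) (Iso.refl _) e.symm
  have hN2 : t₂.heart (N⟦(1 : ℤ)⟧) := heart_of_iso _ e.symm hN'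
  have hN1' : ¬ IsZero (N⟦(1 : ℤ)⟧) := fun h => hN0' (h.of_iso e.symm)
  have hN0 : ¬ IsZero N := fun h => hN1' ((isZero_shift_iff _ _).2 h)
  refine PhaseLE.trans ?_ (.of_eventuallyEq (P.invariant₂ _ _ ⟨e⟩ hN2 hN1'))
  have hN1 : t₁.heart N := by
    have h1 := (P.amplitude' _ hN2).1
    have h2 : t₁.IsLE (N⟦(1 : ℤ)⟧) (-1) := hT.isLE₃ (-1) (P.amplitude' _ hM).2 g3
    exact (heart_iff _ _).2 ⟨t₁.isLE_of_shift N 0 1 (-1), t₁.isGE_of_shift N 0 1 (-1)⟩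
  obtain ⟨Y₁, Y₀, hM', h11, h12, h01, h02⟩ := P.exists_tri₂ hM
  by_cases h1 : IsZero Y₁
  · have eM := (hM'.iso₂₃ ((isZero_shift_iff _ _).2 h1)).some
    have h0 : ¬ IsZero Y₀ := fun h => hM0 (h.of_iso eM)
    exact (PhaseLE.of_eventuallyEq (P.invariant₂ _ _ ⟨eM⟩ hM hM0)).trans
      ((P.cut₀ _ h01 h02 h0).2.trans (P.cut₁ _ hN1 hN2 hN0).2.le)
  have h1' : ¬ IsZero (Y₁⟦(1 : ℤ)⟧) := fun h => h1 ((isZero_shift_iff _ _).1 h)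
  obtain ⟨C', hC, hC'⟩ := hT.pushout hM'
  obtain ⟨C, ⟨eC⟩⟩ : ∃ C : D, Nonempty (C' ≅ C⟦(1 : ℤ)⟧) :=
    ⟨C'⟦(-1 : ℤ)⟧, ⟨((shiftEquiv D (1 : ℤ)).counitIso.app C').symm⟩⟩
  replace hC : Tri (Y₁⟦(1 : ℤ)⟧) (G⟦(1 : ℤ)⟧) (C⟦(1 : ℤ)⟧) :=
    hC.of_iso (Iso.refl _) (Iso.refl _) eC
  replace hC' : Tri Y₀ (C⟦(1 : ℤ)⟧) (N⟦(1 : ℤ)⟧) := hC'.of_iso (Iso.refl _) eC (Iso.refl _)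
  let u (X : D) : X⟦(1 : ℤ)⟧⟦(-1 : ℤ)⟧ ≅ X := ((shiftEquiv D (1 : ℤ)).unitIso.app X).symm
  have hYGC : Tri Y₁ G C := (hC.shift (-1)).of_iso (u _) (u _) (u _)
  have hCNY : Tri C N Y₀ := (hC'.rotate.shift (-1)).of_iso (u _) (u _) (u _)
  have hC2 : t₂.heart (C⟦(1 : ℤ)⟧) := hC'.heart₂ h02 hN2
  have hC1 : t₁.heart C := by
    have h1 := (P.amplitude' _ hC2).1
    exact (heart_iff _ _).2 ⟨hYGC.isLE₃ 0
      (by have := ((heart_iff _ _).1 h11).1; exact t₁.isLE_of_le _ 0 _) g1,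
      t₁.isGE_of_shift C 0 1 (-1)⟩
  have hC0 : ¬ IsZero C := by
    intro h
    have e' : N ≅ Y₀ := (hCNY.iso₂₃ h).some
    exact hN0 (isZero_of_heart_shift (heart_of_iso _ e'.symm h02) hN2)
  have hCN := P.seesaw₁.left_le_middle P.invariant₁ hCNY hC1 hN1 h01 hC0 hN0 fun h =>
    (P.cut₁ _ hC1 hC2 hC0).1.trans_lt (P.cut₀ _ h01 h02 h).1
  have hYC := hG.2.2 _ _ hYGC h11 hC1 h1 hC0
  refine PhaseLE.trans ?_ ((P.mono₁ _ _ h11 h12 hN1 hN2 h1 hN0).2 (hYC.trans hCN))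
  exact P.seesaw₂.middle_le_left P.invariant₂ hM' h12 hM h02 h1' hM0 fun h =>
    (P.cut₀ _ h01 h02 h).2.trans_lt (P.cut₁ _ h11 h12 h1).2

/-- The top factor is a quotient of a torsion object, hence torsion with phase above c; the other
factors have larger phase, so they cannot be torsion-free. -/
theorem heart_of_mem₀ {E : D} {l : List D} (h : HNSeq t₁ φ₁ E l) (hE : t₂.heart E) :
    ∀ Q ∈ l, t₂.heart Q := by
  cases h with
  | nil h => simp
  | @cons E' _ Q l h hT hQ hl =>
    have hQ2 : t₂.heart Q := (heart_iff _ _).2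
      ⟨hT.isLE₃ 0 (P.amplitude _ h.heart).2 ((heart_iff _ _).1 hE).1, (P.amplitude _ hQ.1).1⟩
    intro Q' hQ'
    rcases List.mem_cons.1 hQ' with rfl | hQ'
    · exact hQ2
    have hss := h.semistable _ hQ'
    refine (P.heart_or_heart_shift hss).resolve_right fun h2 => ?_
    exact ((P.cut₀ _ hQ.1 hQ2 hQ.2.1).1.trans (hl _ hQ')).not_le
      (P.cut₁ _ hss.1 h2 hss.2.1).1

/-- Subobjects of torsion-free objects are torsion-free, so induction handles the lower steps. Their
factors have phase at most c, and the top factor has smaller phase still. -/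
theorem heart_shift_of_mem₁ {E : D} {l : List D} (h : HNSeq t₁ φ₁ E l) :
    t₂.heart (E⟦(1 : ℤ)⟧) → ∀ Q ∈ l, t₂.heart (Q⟦(1 : ℤ)⟧) := by
  induction h with
  | nil h => simp
  | @cons E' E Q l h hT hQ hl ih =>
    intro hE
    have hE' : t₂.heart (E'⟦(1 : ℤ)⟧) := by
      obtain ⟨h1, h2⟩ := P.amplitude _ h.heart
      obtain ⟨q1, q2⟩ := P.amplitude _ hQ.1
      exact (heart_iff _ _).2 ⟨t₂.isLE_shift E' 1 1 0,
        (hT.shift 1).isGE₁ 0 ((heart_iff _ _).1 hE).2 (t₂.isGE_shift Q 0 1 (0 - 1))⟩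
    replace ih := ih hE'
    intro Q' hQ'
    rcases List.mem_cons.1 hQ' with rfl | hQ'
    · cases l with
      -- With no lower factor to compare with, the top factor is the object itself.
      | nil =>
        cases h with
        | nil hz =>
          exact heart_of_iso _ ((shiftFunctor D (1 : ℤ)).mapIso (hT.iso₂₃ hz).some) hE
      | cons Q'' l =>
        refine (P.heart_or_heart_shift hQ).resolve_left fun h2 => ?_
        have hss := h.semistable Q'' List.mem_cons_self
        exact ((P.cut₀ _ hQ.1 h2 hQ.2.1).1.trans (hl _ List.mem_cons_self)).not_le
          (P.cut₁ _ hss.1 (ih _ List.mem_cons_self) hss.2.1).1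
    · exact ih _ hQ'

theorem hnSeq₀ {E : D} {l : List D} (h : HNSeq t₁ φ₁ E l) (hl : ∀ Q ∈ l, t₂.heart Q) :
    HNSeq t₂ φ₂ E l := by
  induction h with
  | nil h => exact .nil h
  | @cons E' E Q l h hT hQ hlt ih =>
    have hQ2 := hl Q List.mem_cons_self
    have hl' : ∀ Q' ∈ l, t₂.heart Q' := fun Q' hQ' => hl Q' (List.mem_cons_of_mem _ hQ')
    refine .cons (ih hl') hT (P.semistable₀ hQ hQ2) fun Q' hQ' => ?_
    have hss := h.semistable _ hQ'
    exact (P.mono₀ _ _ hQ.1 hQ2 hss.1 (hl' _ hQ') hQ.2.1 hss.2.1).1 (hlt _ hQ')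

theorem hnSeq₁ {E : D} {l : List D} (h : HNSeq t₁ φ₁ E l) (hl : ∀ Q ∈ l, t₂.heart (Q⟦(1 : ℤ)⟧)) :
    HNSeq t₂ φ₂ (E⟦(1 : ℤ)⟧) (l.map fun Q => Q⟦(1 : ℤ)⟧) := by
  induction h with
  | nil h => exact .nil ((isZero_shift_iff _ _).2 h)
  | @cons E' E Q l h hT hQ hlt ih =>
    have hQ2 := hl Q List.mem_cons_self
    have hl' : ∀ Q' ∈ l, t₂.heart (Q'⟦(1 : ℤ)⟧) := fun Q' hQ' => hl Q' (List.mem_cons_of_mem _ hQ')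
    refine .cons (ih hl') (hT.shift 1) (P.semistable₁ hQ hQ2) fun Q'' hQ'' => ?_
    obtain ⟨Q', hQ', rfl⟩ := List.mem_map.1 hQ''
    have hss := h.semistable _ hQ'
    exact (P.mono₁ _ _ hQ.1 hQ2 hss.1 (hl' _ hQ') hQ.2.1 hss.2.1).1 (hlt _ hQ')

/-- The factors of Y₁[1] have phase above d and those of Y₀ at most d, so concatenation preserves
the strict decrease. -/
theorem exists_hnSeq (hn : ∀ E : D, t₁.heart E → ∃ l, HNSeq t₁ φ₁ E l) (F : D)
    (hF : t₂.heart F) : ∃ l, HNSeq t₂ φ₂ F l := by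
  obtain ⟨Y₁, Y₀, hT, h11, h12, h01, h02⟩ := P.exists_tri₂ hF
  obtain ⟨l₁, hl₁⟩ := hn Y₁ h11
  obtain ⟨l₀, hl₀⟩ := hn Y₀ h01
  have m₁ := P.heart_shift_of_mem₁ hl₁ h12
  have m₀ := P.heart_of_mem₀ hl₀ h02
  refine ⟨_, (P.hnSeq₁ hl₁ m₁).append (P.hnSeq₀ hl₀ m₀) ?_ hT⟩
  intro Q₀ hQ₀ Q' hQ'
  obtain ⟨Q₁, hQ₁, rfl⟩ := List.mem_map.1 hQ'
  have s₀ := hl₀.semistable _ hQ₀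
  have s₁ := hl₁.semistable _ hQ₁
  exact (P.cut₀ _ s₀.1 (m₀ _ hQ₀) s₀.2.1).2.trans_lt (P.cut₁ _ s₁.1 (m₁ _ hQ₁) s₁.2.1).2

end TiltedPhases

end

/-! ### Classes in the Grothendieck group and phases -/

section

variable {D : Type u₁} [Category.{v₁} D] [Preadditive D] [HasZeroObject D] [HasShift D ℤ]
  [∀ n : ℤ, (shiftFunctor D n).Additive] [Pretriangulated D]

theorem K0.of_tri {X Y Z : D} (h : Tri X Y Z) : K0.of Y = K0.of X + K0.of Z := by
  obtain ⟨f, g, h, hT⟩ := h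
  have hmem : FreeAbelianGroup.of Y - FreeAbelianGroup.of X - FreeAbelianGroup.of Z ∈
      K0Relations D := AddSubgroup.subset_closure ⟨_, hT, rfl⟩
  have h0 := (QuotientAddGroup.eq_zero_iff _).2 hmem
  rw [QuotientAddGroup.mk_sub, QuotientAddGroup.mk_sub, sub_sub, sub_eq_zero] at h0
  exact h0

theorem K0.of_isZero {X : D} (h : IsZero X) : K0.of X = 0 := by
  have := K0.of_tri (Tri.of_isZero₁ h (Iso.refl X))
  simpa using this

theorem K0.of_iso {X Y : D} (e : X ≅ Y) : K0.of X = K0.of Y := by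
  have := K0.of_tri (Tri.of_isZero₁ (isZero_zero D) e)
  rwa [K0.of_isZero (isZero_zero D), zero_add] at this

theorem K0.of_shift_one (X : D) : K0.of (X⟦(1 : ℤ)⟧) = -K0.of X := by
  have := K0.of_tri (Tri.of_isZero₃ (isZero_zero D) (Iso.refl X)).rotate
  rw [K0.of_isZero (isZero_zero D)] at this
  exact eq_neg_of_add_eq_zero_right this.symm

namespace StabilityData

variable {t : TStructure D} {φ₀ : ℝ → ℝ} (σ : StabilityData t φ₀)

open Classical in
/-- The phase of an object of the triangulated category, with a junk value outside the heart. -/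
noncomputable def objPhase (X : D) : ℝ → ℝ :=
  if h : t.heart X then σ.phase ⟨X, h⟩ else 0

theorem objPhase_of_heart {X : D} (h : t.heart X) : σ.objPhase X = σ.phase ⟨X, h⟩ := dif_pos h

theorem objPhase_obj (E : HeartCat t) : σ.objPhase E.obj = σ.phase E :=
  σ.objPhase_of_heart E.2

theorem phase_of_eq_zero {E : HeartCat t} (h : σ.Z (K0.of E.obj) = 0) :
    σ.phase E = σ.kerPhase E := if_pos h

theorem phase_of_ne_zero {E : HeartCat t} (h : σ.Z (K0.of E.obj) ≠ 0) :
    σ.phase E = phaseOf φ₀ (σ.Z (K0.of E.obj)) := if_neg h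

theorem phaseInvariant : PhaseInvariant t σ.objPhase := by
  rintro X Y ⟨e⟩ hX hX0
  have hY : t.heart Y := heart_of_iso t e hX
  rw [σ.objPhase_of_heart hX, σ.objPhase_of_heart hY]
  by_cases h : σ.Z (K0.of X) = 0
  · rw [σ.phase_of_eq_zero h, σ.phase_of_eq_zero (K0.of_iso e ▸ h)]
    exact σ.kerPhase_congr _ _ ⟨hX, h⟩ (fun h' => hX0 ((isZero_iff_obj _).1 h'))
      ⟨t.heart.fullyFaithfulι.preimageIso e⟩
  · rw [σ.phase_of_ne_zero h, σ.phase_of_ne_zero (K0.of_iso e ▸ h)]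
    simp only [K0.of_iso e]
    rfl

/-- `Q` is the quotient `B / A` of the subobjects `A ≤ B`. -/
def IsSubquotient {E : HeartCat t} (A B : Subobject E) (Q : HeartCat t) : Prop :=
  ∃ (h : A ≤ B) (π : (B : HeartCat t) ⟶ Q) (w : A.ofLE B h ≫ π = 0),
    (ShortComplex.mk _ _ w).ShortExact

/-- Allows filtration steps to be checked on chosen representatives of subobjects. -/
theorem IsSubquotient.of_mono {E X Y Q : HeartCat t} (f : X ⟶ E) (g : Y ⟶ E) [Mono f] [Mono g]
    (k : X ⟶ Y) (hk : k ≫ g = f) (p : Y ⟶ Q) (w : k ≫ p = 0)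
    (hS : (ShortComplex.mk k p w).ShortExact) :
    IsSubquotient (Subobject.mk f) (Subobject.mk g) Q := by
  have hle : Subobject.mk f ≤ Subobject.mk g := Subobject.mk_le_mk_of_comm k hk
  have hk' : (Subobject.mk f).ofLE (Subobject.mk g) hle ≫ (Subobject.underlyingIso g).hom =
      (Subobject.underlyingIso f).hom ≫ k := by
    rw [← cancel_mono g, Category.assoc, Category.assoc, hk, Subobject.underlyingIso_hom_comp_eq_mk,
      Subobject.underlyingIso_hom_comp_eq_mk, Subobject.ofLE_arrow]
  refine ⟨hle, (Subobject.underlyingIso g).hom ≫ p, ?_, ?_⟩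
  · rw [← Category.assoc, hk', Category.assoc, w, comp_zero]
  · refine ShortComplex.shortExact_of_iso (S₁ := .mk k p w) (ShortComplex.isoMk
      (Subobject.underlyingIso f).symm (Subobject.underlyingIso g).symm (Iso.refl _) ?_ ?_) hS
    · change (Subobject.underlyingIso f).inv ≫ (Subobject.mk f).ofLE (Subobject.mk g) hle =
        k ≫ (Subobject.underlyingIso g).inv
      rw [Iso.inv_comp_eq, ← Category.assoc, ← hk', Category.assoc, Iso.hom_inv_id,
        Category.comp_id]
    · change (Subobject.underlyingIso g).inv ≫ (Subobject.underlyingIso g).hom ≫ p = p ≫ 𝟙 _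
      simp

/-- Were the inclusion an equality, the quotient map would be both zero and epi. -/
theorem IsSubquotient.lt {E : HeartCat t} {A B : Subobject E} {Q : HeartCat t}
    (h : IsSubquotient A B Q) (hQ : ¬ IsZero Q) : A < B := by
  obtain ⟨hle, π, w, hS⟩ := h
  refine lt_of_le_not_ge hle fun hle' => hQ ?_
  have hπ : π = 0 := by
    have : π = B.ofLE A hle' ≫ A.ofLE B hle ≫ π := by
      rw [← Category.assoc, Subobject.ofLE_comp_ofLE, Subobject.ofLE_refl, Category.id_comp]
    rw [this, w, comp_zero]
  have : Epi π := hS.epi_g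
  rw [IsZero.iff_id_eq_zero, ← cancel_epi π, hπ, zero_comp, zero_comp]

variable [IsTriangulated D]

theorem WeakSeesaw.triSeesaw {σ : StabilityData t φ₀} (h : σ.WeakSeesaw) :
    TriSeesaw t σ.objPhase := by
  intro X Y Z hT hX hY hZ hX0 hY0 hZ0
  obtain ⟨f, g, w, hS⟩ := exists_shortExact_of_tri (X := ⟨X, hX⟩) (Y := ⟨Y, hY⟩) (Z := ⟨Z, hZ⟩) hT
  have := h _ hS (fun h => hX0 ((isZero_iff_obj _).1 h)) (fun h => hY0 ((isZero_iff_obj _).1 h))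
    (fun h => hZ0 ((isZero_iff_obj _).1 h))
  rwa [← σ.objPhase_obj, ← σ.objPhase_obj, ← σ.objPhase_obj] at this

theorem isSemistable_iff (E : HeartCat t) :
    σ.IsSemistable E ↔ TriSemistable t σ.objPhase E.obj := by
  constructor
  · rintro ⟨h0, h⟩
    refine ⟨E.2, fun h' => h0 ((isZero_iff_obj _).2 h'), fun M N hT hM hN hM0 hN0 => ?_⟩
    obtain ⟨f, g, w, hS⟩ := exists_shortExact_of_tri (X := ⟨M, hM⟩) (Y := E) (Z := ⟨N, hN⟩) hT
    have := h _ _ f g w hS (fun h => hM0 ((isZero_iff_obj _).1 h))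
      (fun h => hN0 ((isZero_iff_obj _).1 h))
    rwa [← σ.objPhase_obj, ← σ.objPhase_obj] at this
  · rintro ⟨-, h0, h⟩
    refine ⟨fun h' => h0 ((isZero_iff_obj _).1 h'), fun M N i p w hS hM0 hN0 => ?_⟩
    rw [← σ.objPhase_obj, ← σ.objPhase_obj]
    exact h _ _ (tri_of_shortExact hS) M.2 N.2 (fun h' => hM0 ((isZero_iff_obj _).2 h'))
      (fun h' => hN0 ((isZero_iff_obj _).2 h'))

/-! ### Harder–Narasimhan filtrations by subobjects and by triangles -/

theorem HNFiltration.exists_hnSeq {σ : StabilityData t φ₀} {E : HeartCat t}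
    (H : σ.HNFiltration E) : ∃ l, HNSeq t σ.objPhase E.obj l := by
  -- Recording the index of each factor lets the phase of the next one be compared with all earlier
  -- ones.
  have key : ∀ i : Fin (H.m + 1), ∃ l, HNSeq t σ.objPhase (H.F i : HeartCat t).obj l ∧
      ∀ Q ∈ l, ∃ j : Fin H.m, j.castSucc < i ∧ Q = (H.Q j).obj := by
    intro i
    induction i using Fin.induction with
    | zero => exact ⟨[], .nil ((isZero_iff_obj _).1 H.isZero_zero), by simp⟩
    | succ i ih =>
      obtain ⟨l, hl, hl'⟩ := ih
      refine ⟨(H.Q i).obj :: l, .cons hl (tri_of_shortExact (H.shortExact i))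
        ((σ.isSemistable_iff _).1 (H.semistable i)) ?_, ?_⟩
      · intro Q' hQ'
        obtain ⟨j, hj, rfl⟩ := hl' _ hQ'
        rw [σ.objPhase_obj, σ.objPhase_obj]
        exact H.phase_lt j i (Fin.castSucc_lt_castSucc_iff.1 hj)
      · intro Q' hQ'
        rcases List.mem_cons.1 hQ' with rfl | hQ'
        · exact ⟨i, Fin.castSucc_lt_succ, rfl⟩
        · obtain ⟨j, hj, rfl⟩ := hl' _ hQ'
          exact ⟨j, hj.trans Fin.castSucc_lt_succ, rfl⟩
  obtain ⟨l, hl, -⟩ := key (Fin.last _)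
  rw [H.last_eq_top] at hl
  exact ⟨l, hl.of_iso (t.heart.ι.mapIso (asIso (⊤ : Subobject E).arrow))⟩

/-- The filtration of the penultimate step is pushed forward along its inclusion into `E`, and `⊤`
is appended. Membership of the factors in `l` is carried along to compare their phases with the new
top factor. -/
theorem exists_filtration_of_hnSeq {X : D} {l : List D} (h : HNSeq t σ.objPhase X l) :
    ∀ E : HeartCat t, E.obj = X → ∃ (m : ℕ) (F : Fin (m + 1) → Subobject E) (Q : Fin m → HeartCat t),
      IsZero (F 0 : HeartCat t) ∧ F (Fin.last m) = ⊤ ∧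
      (∀ i : Fin m, IsSubquotient (F i.castSucc) (F i.succ) (Q i)) ∧
      (∀ i, σ.IsSemistable (Q i)) ∧
      (∀ i j, i < j → PhaseLT (σ.phase (Q j)) (σ.phase (Q i))) ∧ ∀ i, (Q i).obj ∈ l := by
  induction h with
  | nil hz =>
    rintro E rfl
    refine ⟨0, fun _ => ⊤, Fin.elim0, ?_, rfl, fun i => i.elim0, fun i => i.elim0,
      fun i => i.elim0, fun i => i.elim0⟩
    exact ((isZero_iff_obj E).2 hz).of_iso (asIso (⊤ : Subobject E).arrow)
  | @cons X' X Q₀ l h hT hQ hlt ih =>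
    rintro E rfl
    obtain ⟨m, F, Q, hF0, hF1, hF, hss, hph, hmem⟩ := ih ⟨X', h.heart⟩ rfl
    obtain ⟨f, p, w, hS⟩ := exists_shortExact_of_tri (X := ⟨X', h.heart⟩) (Y := E)
      (Z := ⟨Q₀, hQ.1⟩) hT
    have : Mono f := hS.mono_f
    refine ⟨m + 1, Fin.snoc (fun i => Subobject.mk ((F i).arrow ≫ f)) ⊤,
      Fin.snoc Q ⟨Q₀, hQ.1⟩, ?_, ?_, ?_, ?_, ?_, ?_⟩
    · rw [← Fin.castSucc_zero, Fin.snoc_castSucc (α := fun _ => Subobject E)]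
      exact hF0.of_iso (Subobject.underlyingIso _)
    · exact Fin.snoc_last (α := fun _ => Subobject E) _ _
    · intro i
      induction i using Fin.lastCases with
      | cast i =>
        rw [Fin.succ_castSucc, Fin.snoc_castSucc (α := fun _ => Subobject E),
          Fin.snoc_castSucc (α := fun _ => Subobject E),
          Fin.snoc_castSucc (α := fun _ => HeartCat t)]
        obtain ⟨hle, π, w', hS'⟩ := hF i
        exact IsSubquotient.of_mono _ _ _ (by rw [← Category.assoc, Subobject.ofLE_arrow]) π w' hS'
      | last =>
        rw [Fin.succ_last, Fin.snoc_last (α := fun _ => Subobject E),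
          Fin.snoc_castSucc (α := fun _ => Subobject E),
          Fin.snoc_last (α := fun _ => HeartCat t), hF1]
        refine IsSubquotient.of_mono _ (𝟙 E) ((⊤ : Subobject _).arrow ≫ f) (Category.comp_id _) p
          (by rw [Category.assoc, w, comp_zero]) ?_
        refine ShortComplex.shortExact_of_iso (S₁ := .mk f p w) (ShortComplex.isoMk
          (asIso (⊤ : Subobject _).arrow).symm (Iso.refl _) (Iso.refl _) ?_ ?_) hS
        · simp
        · simp
    · intro i
      induction i using Fin.lastCases with
      | cast i => rw [Fin.snoc_castSucc (α := fun _ => HeartCat t)]; exact hss i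
      | last => rw [Fin.snoc_last (α := fun _ => HeartCat t)]; exact (σ.isSemistable_iff _).2 hQ
    · intro i j hij
      induction j using Fin.lastCases with
      | cast j =>
        induction i using Fin.lastCases with
        | cast i =>
          rw [Fin.snoc_castSucc (α := fun _ => HeartCat t),
            Fin.snoc_castSucc (α := fun _ => HeartCat t)]
          exact hph i j (Fin.castSucc_lt_castSucc_iff.1 hij)
        | last => exact absurd hij (not_lt.2 (Fin.le_last _))
      | last =>
        induction i using Fin.lastCases with
        | cast i =>
          rw [Fin.snoc_castSucc (α := fun _ => HeartCat t),
            Fin.snoc_last (α := fun _ => HeartCat t), ← σ.objPhase_obj, ← σ.objPhase_obj]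
          exact hlt _ (hmem i)
        | last => exact absurd hij (lt_irrefl _)
    · intro i
      induction i using Fin.lastCases with
      | cast i =>
        rw [Fin.snoc_castSucc (α := fun _ => HeartCat t)]
        exact List.mem_cons_of_mem _ (hmem i)
      | last => rw [Fin.snoc_last (α := fun _ => HeartCat t)]; exact List.mem_cons_self

theorem nonempty_hnFiltration_of_hnSeq {E : HeartCat t} (hE : ¬ IsZero E) {l : List D}
    (h : HNSeq t σ.objPhase E.obj l) : Nonempty (σ.HNFiltration E) := by
  obtain ⟨m, F, Q, hF0, hF1, hF, hss, hph, -⟩ := σ.exists_filtration_of_hnSeq h E rfl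
  choose hle π w hS using hF
  have hmono : StrictMono F := Fin.strictMono_iff_lt_succ.2 fun i =>
    IsSubquotient.lt ⟨hle i, π i, w i, hS i⟩ (hss i).1
  refine ⟨⟨m, ?_, F, hmono, hF0, hF1, Q, π, w, hS, hss, hph⟩⟩
  -- With m = 0 the bottom step, which is zero, would equal `⊤`.
  by_contra hm
  obtain rfl : m = 0 := by omega
  rw [show (0 : Fin 1) = Fin.last 0 from rfl, hF1] at hF0
  exact hE (hF0.of_iso (asIso (⊤ : Subobject E).arrow).symm)

theorem hnProperty_iff : σ.HNProperty ↔
    ∀ X : D, t.heart X → ∃ l, HNSeq t σ.objPhase X l := by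
  constructor
  · intro h X hX
    by_cases h0 : IsZero X
    · exact ⟨[], .nil h0⟩
    · exact (h ⟨X, hX⟩ fun h' => h0 ((isZero_iff_obj _).1 h')).some.exists_hnSeq
  · intro h E hE
    obtain ⟨l, hl⟩ := h E.obj E.2
    exact σ.nonempty_hnFiltration_of_hnSeq hE hl

end StabilityData

end

/-! ### Transport along an exact equivalence -/

section

variable {D : Type u₁} [Category.{v₁} D] [Preadditive D] [HasZeroObject D] [HasShift D ℤ]
  [∀ n : ℤ, (shiftFunctor D n).Additive] [Pretriangulated D]
  {U : Type u₂} [Category.{v₂} U] [Preadditive U] [HasZeroObject U] [HasShift U ℤ]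
  [∀ n : ℤ, (shiftFunctor U n).Additive] [Pretriangulated U]
  (Φ : D ⥤ U) [Φ.CommShift ℤ] [Φ.IsTriangulated] [Φ.IsEquivalence]

theorem isZero_obj_iff (X : D) : IsZero (Φ.obj X) ↔ IsZero X := by
  rw [IsZero.iff_id_eq_zero, IsZero.iff_id_eq_zero, ← CategoryTheory.Functor.map_id,
    Functor.map_eq_zero_iff]

theorem tri_map_iff {X Y Z : D} : Tri (Φ.obj X) (Φ.obj Y) (Φ.obj Z) ↔ Tri X Y Z := by
  constructor
  · rintro ⟨f, g, h, hT⟩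
    -- The connecting map lands in a shift taken in `U`, so it is corrected by the commutation of
    -- `Φ` with shifts before being lifted.
    refine ⟨Φ.preimage f, Φ.preimage g, Φ.preimage (h ≫ (Φ.commShiftIso (1 : ℤ)).inv.app X), ?_⟩
    rw [← Φ.map_distinguished_iff]
    have : Φ.mapTriangle.obj (Triangle.mk (Φ.preimage f) (Φ.preimage g)
        (Φ.preimage (h ≫ (Φ.commShiftIso (1 : ℤ)).inv.app X))) = Triangle.mk f g h := by
      change Triangle.mk (Φ.map (Φ.preimage f)) (Φ.map (Φ.preimage g))
        (Φ.map (Φ.preimage (h ≫ (Φ.commShiftIso (1 : ℤ)).inv.app X)) ≫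
          (Φ.commShiftIso (1 : ℤ)).hom.app X) = _
      simp only [Functor.map_preimage, Category.assoc, Iso.inv_hom_id_app]
      exact congrArg (Triangle.mk f g) (Category.comp_id h)
    rw [this]
    exact hT
  · rintro ⟨f, g, h, hT⟩
    exact Tri.of_mem (Φ.map_distinguished _ hT)

/-- The t-structure induced along an exact equivalence. -/
def pullbackTStructure (t : TStructure U) : TStructure D where
  le n := (t.le n).inverseImage Φ
  ge n := (t.ge n).inverseImage Φ
  le_shift n a n' h X hX :=
    (t.le n').prop_of_iso ((Φ.commShiftIso a).app X).symm (t.le_shift n a n' h _ hX)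
  ge_shift n a n' h X hX :=
    (t.ge n').prop_of_iso ((Φ.commShiftIso a).app X).symm (t.ge_shift n a n' h _ hX)
  zero' X Y f hX hY := Φ.map_injective ((t.zero' (Φ.map f) hX hY).trans (Φ.map_zero X Y).symm)
  le_zero_le X hX := t.le_zero_le _ hX
  ge_one_le X hX := t.ge_one_le _ hX
  exists_triangle_zero_one A := by
    obtain ⟨X, Y, hX, hY, f, g, h, hT⟩ := t.exists_triangle_zero_one (Φ.obj A)
    have hT' : Tri (Φ.objPreimage X) A (Φ.objPreimage Y) := (tri_map_iff Φ).1
      (Tri.of_iso ⟨f, g, h, hT⟩ (Φ.objObjPreimageIso X).symm (Iso.refl _)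
        (Φ.objObjPreimageIso Y).symm)
    obtain ⟨f, g, h, hT⟩ := hT'
    exact ⟨_, _, (t.le 0).prop_of_iso (Φ.objObjPreimageIso X).symm hX,
      (t.ge 1).prop_of_iso (Φ.objObjPreimageIso Y).symm hY, f, g, h, hT⟩

theorem pullbackTStructure_isLE_iff (t : TStructure U) (X : D) (n : ℤ) :
    (pullbackTStructure Φ t).IsLE X n ↔ t.IsLE (Φ.obj X) n :=
  ⟨fun h => ⟨h.1⟩, fun h => ⟨h.1⟩⟩

theorem pullbackTStructure_isGE_iff (t : TStructure U) (X : D) (n : ℤ) :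
    (pullbackTStructure Φ t).IsGE X n ↔ t.IsGE (Φ.obj X) n :=
  ⟨fun h => ⟨h.1⟩, fun h => ⟨h.1⟩⟩

variable {Φ} {t : TStructure U} {φ : U → ℝ → ℝ}

theorem TriSeesaw.pullback (h : TriSeesaw t φ) :
    TriSeesaw (pullbackTStructure Φ t) fun X => φ (Φ.obj X) :=
  fun X Y Z hT hX hY hZ hX0 hY0 hZ0 => h _ _ _ ((tri_map_iff Φ).2 hT) hX hY hZ
    ((isZero_obj_iff Φ X).not.2 hX0) ((isZero_obj_iff Φ Y).not.2 hY0)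
    ((isZero_obj_iff Φ Z).not.2 hZ0)

theorem PhaseInvariant.pullback (h : PhaseInvariant t φ) :
    PhaseInvariant (pullbackTStructure Φ t) fun X => φ (Φ.obj X) :=
  fun X _ ⟨e⟩ hX hX0 => h _ _ ⟨Φ.mapIso e⟩ hX ((isZero_obj_iff Φ X).not.2 hX0)

/-- A test triangle in `U` lifts to `D` only up to isomorphism; invariance of the phase absorbs the
difference. -/
theorem TriSemistable.map (hi : PhaseInvariant t φ) {E : D}
    (h : TriSemistable (pullbackTStructure Φ t) (fun X => φ (Φ.obj X)) E) :
    TriSemistable t φ (Φ.obj E) := by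
  refine ⟨h.1, (isZero_obj_iff Φ E).not.2 h.2.1, fun M N hT hM hN hM0 hN0 => ?_⟩
  let eM := Φ.objObjPreimageIso M
  let eN := Φ.objObjPreimageIso N
  have hT' := (tri_map_iff Φ).1 (hT.of_iso eM.symm (Iso.refl _) eN.symm)
  have hN' : t.heart (Φ.obj (Φ.objPreimage N)) := heart_of_iso t eN.symm hN
  have hN0' : ¬ IsZero (Φ.obj (Φ.objPreimage N)) := fun h => hN0 (h.of_iso eN.symm)
  have := h.2.2 _ _ hT' (heart_of_iso t eM.symm hM) hN'
    (fun h => hM0 (((isZero_obj_iff Φ _).2 h).of_iso eM.symm))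
    (fun h => hN0' ((isZero_obj_iff Φ _).2 h))
  exact (PhaseLE.of_eventuallyEq (hi _ _ ⟨eM.symm⟩ hM hM0)).trans
    (this.trans (.of_eventuallyEq (hi _ _ ⟨eN⟩ hN' hN0')))

theorem HNSeq.map (hi : PhaseInvariant t φ) {E : D} {l : List D}
    (h : HNSeq (pullbackTStructure Φ t) (fun X => φ (Φ.obj X)) E l) :
    HNSeq t φ (Φ.obj E) (l.map Φ.obj) := by
  induction h with
  | nil h => exact .nil ((isZero_obj_iff Φ _).2 h)
  | cons h hT hQ hlt ih =>
    refine .cons ih ((tri_map_iff Φ).2 hT) (hQ.map hi) fun Q hQ' => ?_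
    obtain ⟨Q', hmem, rfl⟩ := List.mem_map.1 hQ'
    exact hlt _ hmem

end

/-! ### Configuration III-w -/

section

variable {D : Type u₁} [Category.{v₁} D] [Preadditive D] [HasZeroObject D] [HasShift D ℤ]
  [∀ n : ℤ, (shiftFunctor D n).Additive] [Pretriangulated D]
  {U : Type u₂} [Category.{v₂} U] [Preadditive U] [HasZeroObject U] [HasShift U ℤ]
  [∀ n : ℤ, (shiftFunctor U n).Additive] [Pretriangulated U]
  {Φ : D ⥤ U} {Ψ : U ⥤ D} {tA : TStructure D} {tB : TStructure U} {a b : ℝ → ℝ}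
  {σA : StabilityData tA a} {σB : StabilityData tB b}

/-- The pulled-back heart produces Φ(X) and Φ(X[1]) where the monotonicity hypothesis has Φ(X)[0]
and Φ(X)[1]; the isomorphisms bridge this. -/
theorem phase_mono_of_iso
    (phase_mono : ∀ (i : ℤ) (F' F'' : HeartCat tA) (h' : IsWIT Φ tB i F'.obj)
      (h'' : IsWIT Φ tB i F''.obj), ¬ IsZero F' → ¬ IsZero F'' →
      (PhaseLT (σA.phase F') (σA.phase F'') →
        PhaseLT (σB.phase ⟨(Φ.obj F'.obj)⟦i⟧, h'⟩) (σB.phase ⟨(Φ.obj F''.obj)⟦i⟧, h''⟩)) ∧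
      (PhaseLE (σA.phase F') (σA.phase F'') →
        PhaseLE (σB.phase ⟨(Φ.obj F'.obj)⟦i⟧, h'⟩) (σB.phase ⟨(Φ.obj F''.obj)⟦i⟧, h''⟩)))
    (i : ℤ) {X Y : D} {X' Y' : U} (eX : X' ≅ (Φ.obj X)⟦i⟧) (eY : Y' ≅ (Φ.obj Y)⟦i⟧)
    (hX : tA.heart X) (hX' : tB.heart X') (hY : tA.heart Y) (hY' : tB.heart Y')
    (hX0 : ¬ IsZero X) (hY0 : ¬ IsZero Y) (hX0' : ¬ IsZero X') (hY0' : ¬ IsZero Y') :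
    (PhaseLT (σA.objPhase X) (σA.objPhase Y) → PhaseLT (σB.objPhase X') (σB.objPhase Y')) ∧
    (PhaseLE (σA.objPhase X) (σA.objPhase Y) → PhaseLE (σB.objPhase X') (σB.objPhase Y')) := by
  have hX'' := heart_of_iso tB eX hX'
  have hY'' := heart_of_iso tB eY hY'
  have := phase_mono i ⟨X, hX⟩ ⟨Y, hY⟩ hX'' hY'' ((isZero_iff_obj _).not.2 hX0)
    ((isZero_iff_obj _).not.2 hY0)
  rw [← σA.objPhase_obj, ← σA.objPhase_obj, ← σB.objPhase_obj, ← σB.objPhase_obj] at this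
  have iX := σB.phaseInvariant _ _ ⟨eX⟩ hX' hX0'
  have iY := σB.phaseInvariant _ _ ⟨eY⟩ hY' hY0'
  exact ⟨fun h => (PhaseLE.of_eventuallyEq iX).trans_lt
      ((this.1 h).trans_le (.of_eventuallyEq iY.symm)),
    fun h => (PhaseLE.of_eventuallyEq iX).trans
      ((this.2 h).trans (.of_eventuallyEq iY.symm))⟩

variable {T : GL (Fin 2) (ConvLaurent ℝ)} {L : PhaseLift T} [Φ.CommShift ℤ] [Φ.IsTriangulated]
  [Φ.IsEquivalence]

theorem ConfigIIIw.phase_cut₀ (config : ConfigIIIw Φ Ψ σA σB T L)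
    (kerA_phase : ∀ F : HeartCat tA, kerObj tA σA.Z F.obj → ¬ IsZero F →
      PhaseLT (L.Γinv b) (σA.phase F))
    (kerB_phase : ∀ F : HeartCat tB, kerObj tB σB.Z F.obj → ¬ IsZero F →
      PhaseLE (σB.phase F) fun v => L.Γ a v + 1)
    {X : D} (hX : tA.heart X) (hX' : tB.heart (Φ.obj X)) (hX0 : ¬ IsZero X) :
    PhaseLT (L.Γinv b) (σA.objPhase X) ∧
      PhaseLE (σB.objPhase (Φ.obj X)) fun v => L.Γ a v + 1 := by
  have hX0' : ¬ IsZero (Φ.obj X) := (isZero_obj_iff Φ X).not.2 hX0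
  have hch := config.charge X
  rw [σA.objPhase_of_heart hX, σB.objPhase_of_heart hX']
  by_cases hz : σA.Z (K0.of X) = 0
  · exact ⟨kerA_phase _ ⟨hX, hz⟩ ((isZero_iff_obj _).not.2 hX0),
      kerB_phase _ ⟨hX', (eq_zero_iff_of_toVec_eq hch).2 hz⟩ ((isZero_iff_obj _).not.2 hX0')⟩
  · have hz' : σB.Z (K0.of (Φ.obj X)) ≠ 0 := (eq_zero_iff_of_toVec_eq hch).not.2 hz
    rw [σA.phase_of_ne_zero hz, σB.phase_of_ne_zero hz']
    exact phaseOf_transform L config.lt_Γinv config.Γinv_lt hz hch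
      (σA.isStabilityFunction.mem_sector X hX hX0)
      (σB.isStabilityFunction.mem_sector _ hX' hX0')

theorem ConfigIIIw.phase_cut₁ (config : ConfigIIIw Φ Ψ σA σB T L)
    (ker_eq : (kerObj tA σA.Z).map Φ = kerObj tB σB.Z)
    {X : D} (hX : tA.heart X) (hX' : tB.heart (Φ.obj (X⟦(1 : ℤ)⟧))) (hX0 : ¬ IsZero X) :
    PhaseLE (σA.objPhase X) (L.Γinv b) ∧
      PhaseLT (fun v => L.Γ a v + 1) (σB.objPhase (Φ.obj (X⟦(1 : ℤ)⟧))) := by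
  have hX0' : ¬ IsZero (Φ.obj (X⟦(1 : ℤ)⟧)) :=
    fun h => hX0 ((isZero_shift_iff _ _).1 ((isZero_obj_iff Φ _).1 h))
  have hch := config.charge X
  have hshift : σB.Z (K0.of (Φ.obj (X⟦(1 : ℤ)⟧))) = -σB.Z (K0.of (Φ.obj X)) := by
    have e : Φ.obj (X⟦(1 : ℤ)⟧) ≅ (Φ.obj X)⟦(1 : ℤ)⟧ := (Φ.commShiftIso (1 : ℤ)).app X
    rw [K0.of_iso e, K0.of_shift_one, map_neg]
  -- If the charge vanished, matching of kernels would put Φ(X) as well as Φ(X)[1] in the heart of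
  -- `tB`, forcing X = 0.
  have hz : σA.Z (K0.of X) ≠ 0 := by
    intro hz
    have hk : kerObj tB σB.Z (Φ.obj X) := by
      rw [← ker_eq]
      exact ObjectProperty.prop_map_obj _ Φ ⟨hX, hz⟩
    have hs : tB.heart ((Φ.obj X)⟦(1 : ℤ)⟧) :=
      heart_of_iso tB ((Φ.commShiftIso (1 : ℤ)).app X) hX'
    exact hX0 ((isZero_obj_iff Φ X).1 (isZero_of_heart_shift hk.1 hs))
  have hz' : σB.Z (K0.of (Φ.obj (X⟦(1 : ℤ)⟧))) ≠ 0 := by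
    rw [hshift, neg_ne_zero]
    exact (eq_zero_iff_of_toVec_eq hch).not.2 hz
  have hsec := σB.isStabilityFunction.mem_sector _ hX' hX0'
  rw [σA.objPhase_of_heart hX, σB.objPhase_of_heart hX', σA.phase_of_ne_zero hz,
    σB.phase_of_ne_zero hz']
  simp only [hshift] at hsec ⊢
  exact phaseOf_transform_neg L config.lt_Γinv config.Γinv_lt hz hch
    (σA.isStabilityFunction.mem_sector X hX hX0) hsec

end

end WeakPolyStab

open WeakPolyStab in
theorem mainTheorem11
    {D : Type u₁} [Category.{v₁} D] [Preadditive D] [HasZeroObject D] [HasShift D ℤ]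
    [∀ n : ℤ, (shiftFunctor D n).Additive] [Pretriangulated D] [IsTriangulated D]
    {U : Type u₂} [Category.{v₂} U] [Preadditive U] [HasZeroObject U] [HasShift U ℤ]
    [∀ n : ℤ, (shiftFunctor U n).Additive] [Pretriangulated U] [IsTriangulated U]
    (Φ : D ⥤ U) [Φ.CommShift ℤ] [Φ.IsTriangulated] [Φ.IsEquivalence]
    (Ψ : U ⥤ D) [Ψ.CommShift ℤ] [Ψ.IsTriangulated] [Ψ.IsEquivalence]
    {tA : TStructure D} {tB : TStructure U} {a b : ℝ → ℝ}
    (σA : StabilityData tA a) (σB : StabilityData tB b)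
    (T : GL (Fin 2) (ConvLaurent ℝ)) (L : PhaseLift T)
    (config : ConfigIIIw Φ Ψ σA σB T L)
    (seesawA : σA.WeakSeesaw) (seesawB : σB.WeakSeesaw)
    -- `Φ` matches the kernels
    (ker_eq : (kerObj tA σA.Z).map Φ = kerObj tB σB.Z)
    -- phase bounds on the kernels
    (kerA_phase : ∀ F : HeartCat tA, kerObj tA σA.Z F.obj → ¬ IsZero F →
      PhaseLT (L.Γinv b) (σA.phase F))
    (kerB_phase : ∀ F : HeartCat tB, kerObj tB σB.Z F.obj → ¬ IsZero F →
      PhaseLE (σB.phase F) fun v => L.Γ a v + 1)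
    -- phase order is preserved on WIT objects
    (phase_mono : ∀ (i : ℤ) (F' F'' : HeartCat tA) (h' : IsWIT Φ tB i F'.obj)
      (h'' : IsWIT Φ tB i F''.obj), ¬ IsZero F' → ¬ IsZero F'' →
      (PhaseLT (σA.phase F') (σA.phase F'') →
        PhaseLT (σB.phase ⟨(Φ.obj F'.obj)⟦i⟧, h'⟩) (σB.phase ⟨(Φ.obj F''.obj)⟦i⟧, h''⟩)) ∧
      (PhaseLE (σA.phase F') (σA.phase F'') →
        PhaseLE (σB.phase ⟨(Φ.obj F'.obj)⟦i⟧, h'⟩) (σB.phase ⟨(Φ.obj F''.obj)⟦i⟧, h''⟩)))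
    (phase_mono' : ∀ (i : ℤ) (F' F'' : HeartCat tB) (h' : IsWIT Ψ tA i F'.obj)
      (h'' : IsWIT Ψ tA i F''.obj), ¬ IsZero F' → ¬ IsZero F'' →
      (PhaseLT (σB.phase F') (σB.phase F'') →
        PhaseLT (σA.phase ⟨(Ψ.obj F'.obj)⟦i⟧, h'⟩) (σA.phase ⟨(Ψ.obj F''.obj)⟦i⟧, h''⟩)) ∧
      (PhaseLE (σB.phase F') (σB.phase F'') →
        PhaseLE (σA.phase ⟨(Ψ.obj F'.obj)⟦i⟧, h'⟩) (σA.phase ⟨(Ψ.obj F''.obj)⟦i⟧, h''⟩)))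
    -- the kernels are generated by semistable objects, which stay semistable
    (kerA_gen : σA.KerFinitelyGenerated)
    (kerA_semistable : ∀ F : HeartCat tA, kerObj tA σA.Z F.obj → σA.IsSemistable F →
      σB.IsSemistableObj (Φ.obj F.obj))
    (kerB_gen : σB.KerFinitelyGenerated)
    (kerB_semistable : ∀ F : HeartCat tB, kerObj tB σB.Z F.obj → σB.IsSemistable F →
      σA.IsSemistableObj (Ψ.obj F.obj))
    (hn : σA.HNProperty) : σB.HNProperty := by
  rw [StabilityData.hnProperty_iff] at hn ⊢
  have amplitude : ∀ E : D, tA.heart E →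
      (pullbackTStructure Φ tB).IsGE E 0 ∧ (pullbackTStructure Φ tB).IsLE E 1 := fun E hE => by
    rw [pullbackTStructure_isGE_iff, pullbackTStructure_isLE_iff]
    exact config.amplitude E hE
  have hZ (X : D) (h : ¬ IsZero X) : ¬ IsZero (Φ.obj X) := (isZero_obj_iff Φ X).not.2 h
  have P : TiltedPhases tA (pullbackTStructure Φ tB) σA.objPhase (fun X => σB.objPhase (Φ.obj X))
      (L.Γinv b) (fun v => L.Γ a v + 1) :=
    { amplitude := amplitude
      amplitude' := heart_amplitude_of_bounded amplitude σA.bounded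
      invariant₁ := σA.phaseInvariant
      invariant₂ := σB.phaseInvariant.pullback
      seesaw₁ := seesawA.triSeesaw
      seesaw₂ := seesawB.triSeesaw.pullback
      cut₀ := fun X hX hX' hX0 => config.phase_cut₀ kerA_phase kerB_phase hX hX' hX0
      cut₁ := fun X hX hX' hX0 => config.phase_cut₁ ker_eq hX hX' hX0
      mono₀ := fun X Y hX hX' hY hY' hX0 hY0 => phase_mono_of_iso phase_mono 0
        ((shiftFunctorZero U ℤ).app (Φ.obj X)).symm ((shiftFunctorZero U ℤ).app (Φ.obj Y)).symm
        hX hX' hY hY' hX0 hY0 (hZ X hX0) (hZ Y hY0)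
      mono₁ := fun X Y hX hX' hY hY' hX0 hY0 => phase_mono_of_iso phase_mono 1
        ((Φ.commShiftIso (1 : ℤ)).app X) ((Φ.commShiftIso (1 : ℤ)).app Y) hX hX' hY hY' hX0 hY0
        (hZ _ ((isZero_shift_iff _ _).not.2 hX0)) (hZ _ ((isZero_shift_iff _ _).not.2 hY0)) }
  intro F hF
  -- The filtration is found for a preimage of F in `D` and carried back by `Φ`.
  obtain ⟨l, hl⟩ := P.exists_hnSeq hn (Φ.objPreimage F)
    (heart_of_iso tB (Φ.objObjPreimageIso F).symm hF)
  exact ⟨_, (hl.map σB.phaseInvariant).of_iso (Φ.objObjPreimageIso F)⟩
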